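/- All groups, $G$-sets and bisets are finite. **Conventions.** For groups $G,H,K,L,C$, an $(H\times L\times C)$-set $Y$ and an $(L\times K\times C)$-set $Z$, let $Y\times^d_L Z$ be the set of $L$-orbits on $Y\times Z$ for the action $l\cdot(y,z)=((1,l,1)y,(l,1,1)z)$, with the $(H\times K\times C)$-action $(h,k,c)[y,z]=[(h,1,c)y,(1,k,c)z]$. An $(H\times K\times C)$-set *factors through* $L$ if it is isomorphic to $Y\times^d_L Z$ for some such $Y$ and $Z$. Let $R$ be a commutative ring with identity and $\mathcal Z$ a nonempty class of groups closed under subquotients and direct products. Let $B(H,G)$ be the Grothendieck group, with respect to disjoint unions, of the category of $(H,G)$-bisets, let $RB(H,G)=R\otimes_{\mathbb Z}B(H,G)$, and let $RB(G)=RB(G,1)$. For a $(K,H)$-biset $V$ and an $(H,G)$-biset $U$, $V\times_H U$ is the set of $H$-orbits on $V\times U$ for $(v,u)h=(vh,h^{-1}u)$. A *biset functor* $M$ is an $R$-linear functor to $R$-modules from the category with objects the groups in $\mathcal Z$, with $\mathrm{Hom}(G,H)=RB(H,G)$, with composition induced by $\times_H$ and with the biset $G$ as identity of $G$. The cartesian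 product of bisets induces bilinear maps $RB(H,G)\times RB(H',G')\to RB(H\times H',G\times G')$, $(\varphi,\psi)\mapsto\varphi\times\psi$. For a group isomorphism $f:G\to H$, $\mathrm{Iso}(f)$ is the $(H,G)$-biset $H$ with $h\cdot x\cdot g=hxf(g)$. Let $C$ be a group in $\mathcal Z$. The Green biset functor $RB_C$ is given by $RB_C(G)=RB(G\times C)$, with $RB_C(\varphi)=RB(\varphi\times C)$, where $C$ stands for the $(C,C)$-biset $C$. Its bilinear product $RB_C(G)\times RB_C(H)\to RB_C(G\times H)$ is induced by $(X,Y)\mapsto X\times Y$ with $(g,h,c)(x,y)=((g,c)x,(h,c)y)$, and its identity element $\varepsilon\in RB_C(1)$ is the class of the one-point $(1\times C)$-set. An *$RB_C$-module* is a biset functor $M$ with bilinear products $RB_C(G)\times M(H)\to M(G\times H)$, $(a,m)\mapsto a\times m$, for $G,H\in\mathcal Z$, that satisfy * $(a\times b)\times m=M(\mathrm{Iso}(\alpha))(a\times(b\times m))$ for $a\in RB_C(G)$, $b\in RB_C(H)$, $m\in M(K)$, where $\alpha:G\times(H\times K)\to(G\times H)\times K$ is the canonical isomorphism; * $m=M(\mathrm{Iso}(\lambda))(\varepsilon\times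 m)$ for $m\in M(G)$, where $\lambda:1\times G\to G$ is the canonical isomorphism; * $M(\varphi\times\psi)(a\times m)=RB_C(\varphi)(a)\times M(\psi)(m)$ for $\varphi\in RB(G',G)$, $\psi\in RB(H',H)$, $a\in RB_C(G)$, $m\in M(H)$. A submodule is a family of $R$-submodules $N(G)\subseteq M(G)$ that is stable under all maps $M(\varphi)$ and under all products with elements of $RB_C$. The module $M$ is *simple* if $M\neq0$ and its only submodules are $0$ and $M$. A group $H\in\mathcal Z$ is *minimal* for $M$ if $M(H)\ne0$ and $M(K)=0$ for every $K\in\mathcal Z$ with $|K|<|H|$. **Corollary 4.7.** Let $C$ be a group of prime order. 1. Let $H$ and $K$ be groups of order $n$. If there is a transitive $(H\times K\times C)$-set that does not factor through any group of order smaller than $n$, then $H$ and $K$ are isomorphic. 2. Let $R$ and $\mathcal Z$ be as above, with $C\in\mathcal Z$, and let $S$ be a simple $RB_C$-module. Then any two minimal groups for $S$ are isomorphic. -/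

import Mathlib

open scoped TensorProduct
open MulOpposite (op)

universe u v w

/-! ### Sets with an action of `H × K × C` and their composition -/

section ThreeSets

variable (H L K C : Type u) [Group H] [Group L] [Group K] [Group C]
variable (Y Z : Type u) [MulAction (H × L × C) Y] [MulAction (L × K × C) Z]

/-- The orbit relation of `L` on `Y × Z`. A `(H × L × C)`-set `Y` is an `(H, L)`-biset by
`h y l = (h, l⁻¹, 1) • y` and `Z` is an `(L, K)`-biset by `l z k = (l, k⁻¹, 1) • z`, so
`(y l⁻¹, l z) = ((1, l, 1) • y, (l, 1, 1) • z)`. -/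
def diagSetoid : Setoid (Y × Z) where
  r p q := ∃ l : L, q = (((1, l, 1) : H × L × C) • p.1, ((l, 1, 1) : L × K × C) • p.2)
  iseqv :=
    { refl := fun p => ⟨1, by
        change p = ((1 : H × L × C) • p.1, (1 : L × K × C) • p.2)
        simp⟩
      symm := by
        rintro p q ⟨l, rfl⟩
        refine ⟨l⁻¹, ?_⟩
        simp only [smul_smul, Prod.mk_mul_mk, mul_one, inv_mul_cancel]
        change p = ((1 : H × L × C) • p.1, (1 : L × K × C) • p.2)
        simp
      trans := by
        rintro p q r ⟨l, rfl⟩ ⟨l', rfl⟩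
        exact ⟨l' * l, by simp [smul_smul]⟩ }

/-- The `(H × K × C)`-set `Y ×ᵈ_L Z`: the `L`-orbits on `Y × Z`, where `H` acts on `Y`,
`K` acts on `Z` and `C` acts diagonally. -/
def DiagComp : Type u := Quotient (diagSetoid H L K C Y Z)

instance DiagComp.mulAction : MulAction (H × K × C) (DiagComp H L K C Y Z) where
  smul g := Quotient.map (sa := diagSetoid H L K C Y Z) (sb := diagSetoid H L K C Y Z)
    (fun p => (((g.1, 1, g.2.2) : H × L × C) • p.1, ((1, g.2.1, g.2.2) : L × K × C) • p.2)) (by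
      rintro p q ⟨l, rfl⟩
      refine ⟨l, ?_⟩
      obtain ⟨h, k, c⟩ := g
      simp only [smul_smul, Prod.mk_mul_mk, mul_one, one_mul])
  one_smul x := by
    induction x using Quotient.inductionOn with
    | h p =>
      refine congrArg (Quotient.mk (diagSetoid H L K C Y Z)) ?_
      change ((1 : H × L × C) • p.1, (1 : L × K × C) • p.2) = p
      simp
  mul_smul g g' x := by
    induction x using Quotient.inductionOn with
    | h p =>
      refine congrArg (Quotient.mk (diagSetoid H L K C Y Z)) ?_
      obtain ⟨h, k, c⟩ := g
      obtain ⟨h', k', c'⟩ := g'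
      simp only [smul_smul, Prod.mk_mul_mk, mul_one]

end ThreeSets

/-- The `(H × K × C)`-set `X` factors through the group `L`: it is isomorphic to `Y ×ᵈ_L Z`
for a finite `(H × L × C)`-set `Y` and a finite `(L × K × C)`-set `Z`. -/
def FactorsThrough (H K C X L : Type u) [Group H] [Group K] [Group C] [Group L]
    [MulAction (H × K × C) X] : Prop :=
  ∃ (Y Z : Type u) (_ : Finite Y) (_ : Finite Z)
    (_ : MulAction (H × L × C) Y) (_ : MulAction (L × K × C) Z)
    (e : X ≃ DiagComp H L K C Y Z), ∀ (g : H × K × C) (x : X), e (g • x) = g • e x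

/-! ### Finite bisets -/

/-- A finite `(H, G)`-biset; the right action of `G` is an action of `Gᵐᵒᵖ`. -/
structure Biset (H G : Type u) [Group H] [Group G] where
  carrier : Type u
  [finite : Finite carrier]
  [left : MulAction H carrier]
  [right : MulAction Gᵐᵒᵖ carrier]
  [comm : SMulCommClass H Gᵐᵒᵖ carrier]

namespace Biset

attribute [instance] Biset.finite Biset.left Biset.right Biset.comm

variable {H G H' G' K L : Type u} [Group H] [Group G] [Group H'] [Group G'] [Group K] [Group L]

/-- Isomorphism of bisets. -/
def Iso (U V : Biset H G) : Prop :=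
  ∃ e : U.carrier ≃ V.carrier,
    (∀ (h : H) u, e (h • u) = h • e u) ∧ (∀ (g : G) u, e (op g • u) = op g • e u)

/-- Disjoint union. -/
def sum (U V : Biset H G) : Biset H G where
  carrier := U.carrier ⊕ V.carrier

/-- The `(G, G)`-biset `G`. -/
def id (G : Type u) [Group G] [Finite G] : Biset G G where
  carrier := G

/-- The `(H, G)`-biset `Iso(f)` of a group isomorphism `f : G → H`: the set `H` with
`h x g = h * x * f g`. -/
def ofEquiv [Finite H] (f : G ≃* H) : Biset H G where
  carrier := H
  right :=
    { smul := fun g x => x * f g.unop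
      one_smul := fun x => by
        change x * f 1 = x
        simp
      mul_smul := fun a b x => by
        change x * f (b.unop * a.unop) = x * f b.unop * f a.unop
        simp [mul_assoc] }
  comm := @SMulCommClass.mk _ _ _ (_) (_) fun h g x => (mul_assoc h x (f g.unop)).symm

/-- The cartesian product of an `(H, G)`-biset and an `(H', G')`-biset, which is an
`(H × H', G × G')`-biset. -/
def prod (U : Biset H G) (V : Biset H' G') : Biset (H × H') (G × G') where
  carrier := U.carrier × V.carrier
  left :=
    { smul := fun h x => (h.1 • x.1, h.2 • x.2)
      one_smul := fun x => Prod.ext (one_smul H x.1) (one_smul H' x.2)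
      mul_smul := fun a b x => Prod.ext (mul_smul a.1 b.1 x.1) (mul_smul a.2 b.2 x.2) }
  right :=
    { smul := fun g x => (op g.unop.1 • x.1, op g.unop.2 • x.2)
      one_smul := fun x => Prod.ext (one_smul Gᵐᵒᵖ x.1) (one_smul G'ᵐᵒᵖ x.2)
      mul_smul := fun a b x => Prod.ext
        (mul_smul (op a.unop.1) (op b.unop.1) x.1) (mul_smul (op a.unop.2) (op b.unop.2) x.2) }
  comm := @SMulCommClass.mk _ _ _ (_) (_) fun h g x => Prod.ext
    (smul_comm h.1 (op g.unop.1) x.1) (smul_comm h.2 (op g.unop.2) x.2)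

/-- The orbit relation of the right action `(v, u) h = (v h, h⁻¹ u)` of `H` on `V × U`. -/
def compSetoid (V : Biset K H) (U : Biset H G) : Setoid (V.carrier × U.carrier) where
  r p q := ∃ h : H, q = (op h • p.1, h⁻¹ • p.2)
  iseqv :=
    { refl := fun p => ⟨1, by simp⟩
      symm := by
        rintro p q ⟨h, rfl⟩
        exact ⟨h⁻¹, by simp [smul_smul]⟩
      trans := by
        rintro p q r ⟨h, rfl⟩ ⟨h', rfl⟩
        exact ⟨h * h', by simp [smul_smul]⟩ }

/-- The composition `V ×_H U` of a `(K, H)`-biset and an `(H, G)`-biset. -/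
def comp (V : Biset K H) (U : Biset H G) : Biset K G where
  carrier := Quotient (compSetoid V U)
  left :=
    { smul := fun k => Quotient.map (sa := compSetoid V U) (sb := compSetoid V U)
        (fun p => (k • p.1, p.2)) (by
          rintro p q ⟨h, rfl⟩
          exact ⟨h, by simp [smul_comm]⟩)
      one_smul := fun x => by
        induction x using Quotient.inductionOn with
        | h p =>
          exact congrArg (Quotient.mk (compSetoid V U)) (Prod.ext (one_smul K p.1) rfl)
      mul_smul := fun a b x => by
        induction x using Quotient.inductionOn with
        | h p =>
          exact congrArg (Quotient.mk (compSetoid V U)) (Prod.ext (mul_smul a b p.1) rfl) }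
  right :=
    { smul := fun g => Quotient.map (sa := compSetoid V U) (sb := compSetoid V U)
        (fun p => (p.1, g • p.2)) (by
          rintro p q ⟨h, rfl⟩
          exact ⟨h, by simp [smul_comm]⟩)
      one_smul := fun x => by
        induction x using Quotient.inductionOn with
        | h p =>
          exact congrArg (Quotient.mk (compSetoid V U)) (Prod.ext rfl (one_smul Gᵐᵒᵖ p.2))
      mul_smul := fun a b x => by
        induction x using Quotient.inductionOn with
        | h p =>
          exact congrArg (Quotient.mk (compSetoid V U)) (Prod.ext rfl (mul_smul a b p.2)) }
  comm := @SMulCommClass.mk _ _ _ (_) (_) fun k g x => by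
    induction x using Quotient.inductionOn with
    | h p => rfl

/-- For a `(G × C)`-set `X` and an `(H × C)`-set `Y`, the set `X × Y` with the action
`(g, h, c) (x, y) = ((g, c) x, (h, c) y)` of `(G × H) × C`. This is the restriction of the exterior
product, a `((G × C) × (H × C))`-set, to the subgroup of all `((g, c), (h, c))`, which is
isomorphic to `(G × H) × C`. (Sets with a left action of a group `G` are `(G, 1)`-bisets.) -/
def diagProd {C : Type u} [Group C] (X : Biset (G × C) PUnit.{u + 1})
    (Y : Biset (H × C) PUnit.{u + 1}) : Biset ((G × H) × C) PUnit.{u + 1} where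
  carrier := X.carrier × Y.carrier
  left :=
    { smul := fun g x => (((g.1.1, g.2) : G × C) • x.1, ((g.1.2, g.2) : H × C) • x.2)
      one_smul := fun x => Prod.ext (one_smul (G × C) x.1) (one_smul (H × C) x.2)
      mul_smul := fun a b x => Prod.ext
        (mul_smul ((a.1.1, a.2) : G × C) (b.1.1, b.2) x.1)
        (mul_smul ((a.1.2, a.2) : H × C) (b.1.2, b.2) x.2) }
  right :=
    { smul := fun t x => (t • x.1, t • x.2)
      one_smul := fun x => Prod.ext (one_smul _ x.1) (one_smul _ x.2)
      mul_smul := fun a b x => Prod.ext (mul_smul a b x.1) (mul_smul a b x.2) }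
  comm := @SMulCommClass.mk _ _ _ (_) (_) fun g t x => Prod.ext
    (smul_comm ((g.1.1, g.2) : G × C) t x.1) (smul_comm ((g.1.2, g.2) : H × C) t x.2)

/-- The one-point biset. -/
def point (H G : Type u) [Group H] [Group G] : Biset H G where
  carrier := PUnit.{u + 1}
  left := { smul := fun _ x => x, one_smul := fun _ => rfl, mul_smul := fun _ _ _ => rfl }
  right := { smul := fun _ x => x, one_smul := fun _ => rfl, mul_smul := fun _ _ _ => rfl }
  comm := @SMulCommClass.mk _ _ _ (_) (_) fun _ _ _ => rfl

/-! Compatibility of these constructions with isomorphisms and disjoint unions. -/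

theorem Iso.refl (U : Biset H G) : U.Iso U := ⟨Equiv.refl _, fun _ _ => rfl, fun _ _ => rfl⟩

theorem prod_iso {U₁ U₂ : Biset H G} {V₁ V₂ : Biset H' G'} (hU : U₁.Iso U₂) (hV : V₁.Iso V₂) :
    (U₁.prod V₁).Iso (U₂.prod V₂) := by
  obtain ⟨e, he, he'⟩ := hU
  obtain ⟨f, hf, hf'⟩ := hV
  exact ⟨Equiv.prodCongr e f, fun h x => Prod.ext (he h.1 x.1) (hf h.2 x.2),
    fun g x => Prod.ext (he' g.1 x.1) (hf' g.2 x.2)⟩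

theorem sum_prod (U₁ U₂ : Biset H G) (V : Biset H' G') :
    ((U₁.sum U₂).prod V).Iso ((U₁.prod V).sum (U₂.prod V)) := by
  refine ⟨Equiv.sumProdDistrib _ _ _, ?_, ?_⟩ <;> rintro g ⟨x | x, y⟩ <;> rfl

theorem prod_sum (U : Biset H G) (V₁ V₂ : Biset H' G') :
    (U.prod (V₁.sum V₂)).Iso ((U.prod V₁).sum (U.prod V₂)) := by
  refine ⟨Equiv.prodSumDistrib _ _ _, ?_, ?_⟩ <;> rintro g ⟨x, y | y⟩ <;> rfl

theorem comp_iso {V₁ V₂ : Biset K H} {U₁ U₂ : Biset H G} (hV : V₁.Iso V₂) (hU : U₁.Iso U₂) :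
    (V₁.comp U₁).Iso (V₂.comp U₂) := by
  obtain ⟨e, he, he'⟩ := hV
  obtain ⟨f, hf, hf'⟩ := hU
  refine ⟨Quotient.congr (ra := compSetoid V₁ U₁) (rb := compSetoid V₂ U₂)
    (Equiv.prodCongr e f) ?_, ?_, ?_⟩
  · rintro p q
    refine exists_congr fun h => ?_
    rw [Prod.ext_iff, Prod.ext_iff]
    simp [← he', ← hf]
  · intro k x
    induction x using Quotient.inductionOn with
    | h p => exact congrArg (Quotient.mk (compSetoid V₂ U₂)) (Prod.ext (he k p.1) rfl)
  · intro k x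
    induction x using Quotient.inductionOn with
    | h p => exact congrArg (Quotient.mk (compSetoid V₂ U₂)) (Prod.ext rfl (hf' k p.2))

theorem sum_comp (V₁ V₂ : Biset K H) (U : Biset H G) :
    ((V₁.sum V₂).comp U).Iso ((V₁.comp U).sum (V₂.comp U)) := by
  refine ⟨⟨Quotient.lift (s := compSetoid (V₁.sum V₂) U)
      (fun p => Sum.elim (fun v => Sum.inl (Quotient.mk (compSetoid V₁ U) (v, p.2)))
        (fun v => Sum.inr (Quotient.mk (compSetoid V₂ U) (v, p.2))) p.1) ?_,
    Sum.elim
      (Quotient.map (sa := compSetoid V₁ U) (sb := compSetoid (V₁.sum V₂) U)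
        (fun p => (Sum.inl p.1, p.2)) ?_)
      (Quotient.map (sa := compSetoid V₂ U) (sb := compSetoid (V₁.sum V₂) U)
        (fun p => (Sum.inr p.1, p.2)) ?_), ?_, ?_⟩, ?_, ?_⟩
  · rintro ⟨v | v, x⟩ q ⟨h, rfl⟩
    · exact congrArg Sum.inl (Quotient.sound (s := compSetoid V₁ U) ⟨h, rfl⟩)
    · exact congrArg Sum.inr (Quotient.sound (s := compSetoid V₂ U) ⟨h, rfl⟩)
  · rintro p q ⟨h, rfl⟩
    exact ⟨h, rfl⟩
  · rintro p q ⟨h, rfl⟩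
    exact ⟨h, rfl⟩
  · intro x
    induction x using Quotient.inductionOn with
    | h p => obtain ⟨v | v, x⟩ := p <;> rfl
  · rintro (x | x) <;> induction x using Quotient.inductionOn <;> rfl
  · intro k x
    induction x using Quotient.inductionOn with
    | h p => obtain ⟨v | v, x⟩ := p <;> rfl
  · intro k x
    induction x using Quotient.inductionOn with
    | h p => obtain ⟨v | v, x⟩ := p <;> rfl

theorem comp_sum (V : Biset K H) (U₁ U₂ : Biset H G) :
    (V.comp (U₁.sum U₂)).Iso ((V.comp U₁).sum (V.comp U₂)) := by
  refine ⟨⟨Quotient.lift (s := compSetoid V (U₁.sum U₂))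
      (fun p => Sum.elim (fun x => Sum.inl (Quotient.mk (compSetoid V U₁) (p.1, x)))
        (fun x => Sum.inr (Quotient.mk (compSetoid V U₂) (p.1, x))) p.2) ?_,
    Sum.elim
      (Quotient.map (sa := compSetoid V U₁) (sb := compSetoid V (U₁.sum U₂))
        (fun p => (p.1, Sum.inl p.2)) ?_)
      (Quotient.map (sa := compSetoid V U₂) (sb := compSetoid V (U₁.sum U₂))
        (fun p => (p.1, Sum.inr p.2)) ?_), ?_, ?_⟩, ?_, ?_⟩
  · rintro ⟨v, x | x⟩ q ⟨h, rfl⟩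
    · exact congrArg Sum.inl (Quotient.sound (s := compSetoid V U₁) ⟨h, rfl⟩)
    · exact congrArg Sum.inr (Quotient.sound (s := compSetoid V U₂) ⟨h, rfl⟩)
  · rintro p q ⟨h, rfl⟩
    exact ⟨h, rfl⟩
  · rintro p q ⟨h, rfl⟩
    exact ⟨h, rfl⟩
  · intro x
    induction x using Quotient.inductionOn with
    | h p => obtain ⟨v, x | x⟩ := p <;> rfl
  · rintro (x | x) <;> induction x using Quotient.inductionOn <;> rfl
  · intro k x
    induction x using Quotient.inductionOn with
    | h p => obtain ⟨v, x | x⟩ := p <;> rfl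
  · intro k x
    induction x using Quotient.inductionOn with
    | h p => obtain ⟨v, x | x⟩ := p <;> rfl

section diagProd

variable {C : Type u} [Group C]

theorem diagProd_iso {X₁ X₂ : Biset (G × C) PUnit.{u + 1}} {Y₁ Y₂ : Biset (H × C) PUnit.{u + 1}}
    (hX : X₁.Iso X₂) (hY : Y₁.Iso Y₂) : (X₁.diagProd Y₁).Iso (X₂.diagProd Y₂) := by
  obtain ⟨e, he, he'⟩ := hX
  obtain ⟨f, hf, hf'⟩ := hY
  exact ⟨Equiv.prodCongr e f,
    fun h x => Prod.ext (he (h.1.1, h.2) x.1) (hf (h.1.2, h.2) x.2),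
    fun g x => Prod.ext (he' g x.1) (hf' g x.2)⟩

theorem sum_diagProd (X₁ X₂ : Biset (G × C) PUnit.{u + 1}) (Y : Biset (H × C) PUnit.{u + 1}) :
    ((X₁.sum X₂).diagProd Y).Iso ((X₁.diagProd Y).sum (X₂.diagProd Y)) := by
  refine ⟨Equiv.sumProdDistrib _ _ _, ?_, ?_⟩ <;> rintro g ⟨x | x, y⟩ <;> rfl

theorem diagProd_sum (X : Biset (G × C) PUnit.{u + 1}) (Y₁ Y₂ : Biset (H × C) PUnit.{u + 1}) :
    (X.diagProd (Y₁.sum Y₂)).Iso ((X.diagProd Y₁).sum (X.diagProd Y₂)) := by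
  refine ⟨Equiv.prodSumDistrib _ _ _, ?_, ?_⟩ <;> rintro g ⟨x, y | y⟩ <;> rfl

end diagProd

end Biset

/-! ### Burnside groups of bisets -/

/-- The relations `[U] = [V]` for `U ≅ V` and `[U ⊔ V] = [U] + [V]`. -/
def burnsideRelations (H G : Type u) [Group H] [Group G] :
    AddSubgroup (FreeAbelianGroup (Biset H G)) :=
  AddSubgroup.closure
    ({x | ∃ U V : Biset H G, U.Iso V ∧ x = FreeAbelianGroup.of U - FreeAbelianGroup.of V} ∪
     {x | ∃ U V : Biset H G, x = FreeAbelianGroup.of (U.sum V) -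
        (FreeAbelianGroup.of U + FreeAbelianGroup.of V)})

/-- `B(H, G)`: the Grothendieck group of the category of finite `(H, G)`-bisets, with respect to
disjoint unions. -/
abbrev BurnsideGroup (H G : Type u) [Group H] [Group G] : Type (u + 1) :=
  FreeAbelianGroup (Biset H G) ⧸ burnsideRelations H G

/-- `RB(H, G) = R ⊗ B(H, G)`. -/
abbrev RB (R : Type v) [CommRing R] (H G : Type u) [Group H] [Group G] : Type (max (u + 1) v) :=
  R ⊗[ℤ] BurnsideGroup H G

noncomputable section

namespace RB

variable (R : Type v) [CommRing R]
variable {H G H' G' K L : Type u} [Group H] [Group G] [Group H'] [Group G'] [Group K] [Group L]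

/-- The class of a biset. -/
def of (U : Biset H G) : RB R H G :=
  1 ⊗ₜ[ℤ] (QuotientAddGroup.mk (FreeAbelianGroup.of U) : BurnsideGroup H G)

variable {R}

theorem of_iso {U V : Biset H G} (h : U.Iso V) : of R U = of R V := by
  refine congrArg (fun y : BurnsideGroup H G => (1 : R) ⊗ₜ[ℤ] y) ?_
  refine (QuotientAddGroup.eq_iff_sub_mem).2 (AddSubgroup.subset_closure (Or.inl ?_))
  exact ⟨U, V, h, rfl⟩

theorem of_sum (U V : Biset H G) : of R (U.sum V) = of R U + of R V := by
  rw [of, of, of, ← TensorProduct.tmul_add]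
  refine congrArg (fun y : BurnsideGroup H G => (1 : R) ⊗ₜ[ℤ] y) ?_
  rw [← QuotientAddGroup.mk_add]
  refine (QuotientAddGroup.eq_iff_sub_mem).2 (AddSubgroup.subset_closure (Or.inr ?_))
  exact ⟨U, V, rfl⟩

variable {N : Type w} [AddCommGroup N] [Module R N]

theorem hom_ext {f g : RB R H G →ₗ[R] N} (h : ∀ U, f (of R U) = g (of R U)) : f = g := by
  refine TensorProduct.AlgebraTensorModule.ext fun r y => ?_
  have hr : r ⊗ₜ[ℤ] y = r • ((1 : R) ⊗ₜ[ℤ] y) := by simp [TensorProduct.smul_tmul']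
  rw [hr, map_smul, map_smul]
  congr 1
  clear hr
  induction y using QuotientAddGroup.induction_on with
  | H z =>
    induction z using FreeAbelianGroup.induction_on with
    | zero => simp
    | of U => exact h U
    | neg U hU => simpa [TensorProduct.tmul_neg] using hU
    | add x y hx hy => simp only [QuotientAddGroup.mk_add, TensorProduct.tmul_add, map_add, hx, hy]

/-- The linear extension of an additive isomorphism invariant of bisets. -/
def lift (f : Biset H G → N) (hiso : ∀ U V, U.Iso V → f U = f V)
    (hsum : ∀ U V, f (U.sum V) = f U + f V) : RB R H G →ₗ[R] N :=
  LinearMap.liftBaseChange R (AddMonoidHom.toIntLinearMap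
    (QuotientAddGroup.lift (burnsideRelations H G) (FreeAbelianGroup.lift f) (by
      refine (AddSubgroup.closure_le _).2 ?_
      rintro x (⟨U, V, h, rfl⟩ | ⟨U, V, rfl⟩)
      · simp [hiso U V h, AddMonoidHom.mem_ker]
      · simp [hsum U V, AddMonoidHom.mem_ker])))

@[simp] theorem lift_of (f : Biset H G → N) (hiso hsum) (U : Biset H G) :
    lift (R := R) f hiso hsum (of R U) = f U := by
  simp only [lift, of, LinearMap.liftBaseChange_tmul, one_smul]
  exact FreeAbelianGroup.lift_apply_of f U

/-- The bilinear extension of a biadditive isomorphism invariant of pairs of bisets. -/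
def lift₂ (f : Biset H G → Biset H' G' → N)
    (hiso : ∀ U₁ U₂ V₁ V₂, U₁.Iso U₂ → V₁.Iso V₂ → f U₁ V₁ = f U₂ V₂)
    (hl : ∀ U₁ U₂ V, f (U₁.sum U₂) V = f U₁ V + f U₂ V)
    (hr : ∀ U V₁ V₂, f U (V₁.sum V₂) = f U V₁ + f U V₂) :
    RB R H G →ₗ[R] RB R H' G' →ₗ[R] N :=
  lift (fun U => lift (f U) (fun V₁ V₂ h => hiso U U V₁ V₂ (Biset.Iso.refl U) h) (hr U))
    (fun U₁ U₂ h => hom_ext fun V => by simp [hiso U₁ U₂ V V h (Biset.Iso.refl V)])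
    (fun U₁ U₂ => hom_ext fun V => by simp [hl])

@[simp] theorem lift₂_of (f : Biset H G → Biset H' G' → N) (hiso hl hr) (U : Biset H G)
    (V : Biset H' G') : lift₂ (R := R) f hiso hl hr (of R U) (of R V) = f U V := by
  simp [lift₂]

variable (R)

/-- Composition in the biset category, `RB(K, H) × RB(H, G) → RB(K, G)`, the bilinear extension of
`(V, U) ↦ V ×_H U`. -/
def comp : RB R K H →ₗ[R] RB R H G →ₗ[R] RB R K G :=
  lift₂ (fun V U => of R (V.comp U)) (fun _ _ _ _ h h' => of_iso (Biset.comp_iso h h'))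
    (fun V₁ V₂ U => (of_iso (Biset.sum_comp V₁ V₂ U)).trans (of_sum _ _))
    (fun V U₁ U₂ => (of_iso (Biset.comp_sum V U₁ U₂)).trans (of_sum _ _))

/-- `RB(H, G) × RB(H', G') → RB(H × H', G × G')`, the bilinear extension of the cartesian
product. -/
def prod : RB R H G →ₗ[R] RB R H' G' →ₗ[R] RB R (H × H') (G × G') :=
  lift₂ (fun U V => of R (U.prod V)) (fun _ _ _ _ h h' => of_iso (Biset.prod_iso h h'))
    (fun U₁ U₂ V => (of_iso (Biset.sum_prod U₁ U₂ V)).trans (of_sum _ _))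
    (fun U V₁ V₂ => (of_iso (Biset.prod_sum U V₁ V₂)).trans (of_sum _ _))

end RB

/-! ### The Green biset functor `RB_C` -/

/-- `RB_C(G) = RB(G × C)`, where `RB(G) = RB(G, 1)` is the Burnside module of `G`-sets. -/
abbrev RBC (R : Type v) [CommRing R] (C G : Type u) [Group C] [Group G] : Type (max (u + 1) v) :=
  RB R (G × C) PUnit.{u + 1}

namespace RBC

variable (R : Type v) [CommRing R] (C : Type u) [Group C]
variable {G H : Type u} [Group G] [Group H]

/-- `RB_C(φ) = RB(φ × C)` for `φ` in `RB(H, G)`. -/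
def map [Finite C] (φ : RB R H G) : RBC R C G →ₗ[R] RBC R C H :=
  RB.comp R (RB.prod R φ (RB.of R (Biset.id C)))

/-- The product `RB_C(G) × RB_C(H) → RB_C(G × H)`. -/
def mul : RBC R C G →ₗ[R] RBC R C H →ₗ[R] RBC R C (G × H) :=
  RB.lift₂ (fun X Y => RB.of R (X.diagProd Y))
    (fun _ _ _ _ h h' => RB.of_iso (Biset.diagProd_iso h h'))
    (fun X₁ X₂ Y => (RB.of_iso (Biset.sum_diagProd X₁ X₂ Y)).trans (RB.of_sum _ _))
    (fun X Y₁ Y₂ => (RB.of_iso (Biset.diagProd_sum X Y₁ Y₂)).trans (RB.of_sum _ _))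

/-- The identity element in `RB_C(1)`: the class of the `(1 × C)`-set with one point. -/
def one : RBC R C PUnit.{u + 1} :=
  RB.of R (Biset.point (PUnit.{u + 1} × C) PUnit.{u + 1})

end RBC

end

/-! ### Biset functors on a class of finite groups, and modules over `RB_C` -/

/-- A (nonempty) class of finite groups closed under subquotients and direct products. In
particular it is closed under isomorphisms. -/
structure GroupClass where
  Mem : ∀ (G : Type u) [Group G], Prop
  finite : ∀ (G : Type u) [Group G], Mem G → Finite G
  trivial : Mem PUnit.{u + 1}
  subquotient : ∀ (G Q : Type u) [Group G] [Group Q] (D : Subgroup G) (f : D →* Q),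
    Function.Surjective f → Mem G → Mem Q
  prod : ∀ (G H : Type u) [Group G] [Group H], Mem G → Mem H → Mem (G × H)

/-- A group in the class `Z`. -/
structure GroupClass.Obj (Z : GroupClass.{u}) where
  carrier : Type u
  [group : Group carrier]
  mem : Z.Mem carrier

namespace GroupClass

variable {Z : GroupClass.{u}}

instance : CoeSort Z.Obj (Type u) := ⟨Obj.carrier⟩

instance (G : Z.Obj) : Group G := G.group

instance (G : Z.Obj) : Finite G := Z.finite G G.mem

/-- The direct product in `Z`. -/
abbrev Obj.prod (G H : Z.Obj) : Z.Obj := ⟨G × H, Z.prod G H G.mem H.mem⟩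

/-- The trivial group in `Z`. -/
abbrev Obj.one (Z : GroupClass.{u}) : Z.Obj := ⟨PUnit.{u + 1}, Z.trivial⟩

end GroupClass

/-- An `R`-linear functor to `R`-modules from the biset category, whose objects are the
groups in `Z` and whose morphisms from `G` to `H` are the elements of `RB(H, G)`. -/
structure BisetFunctor (R : Type v) [CommRing R] (Z : GroupClass.{u}) where
  obj : Z.Obj → Type w
  [addCommGroup : ∀ G, AddCommGroup (obj G)]
  [module : ∀ G, Module R (obj G)]
  map : ∀ {H G : Z.Obj}, RB R H G →ₗ[R] obj G →ₗ[R] obj H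
  map_id : ∀ (G : Z.Obj) (m : obj G), map (RB.of R (Biset.id G)) m = m
  map_comp : ∀ {K H G : Z.Obj} (β : RB R K H) (α : RB R H G) (m : obj G),
    map (RB.comp R β α : RB R K G) m = map β (map α m)

attribute [instance] BisetFunctor.addCommGroup BisetFunctor.module

/-- `H` is a minimal group for `M`: `M(H) ≠ 0` and `M(K) = 0` whenever `|K| < |H|`. -/
def BisetFunctor.IsMinimalGroup {R : Type v} [CommRing R] {Z : GroupClass.{u}}
    (M : BisetFunctor.{u, v, w} R Z) (H : Z.Obj) : Prop :=
  Nontrivial (M.obj H) ∧ ∀ K : Z.Obj, Nat.card K < Nat.card H → Subsingleton (M.obj K)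

/-- A module over the Green biset functor `RB_C`: a biset functor `M` with bilinear products
`RB_C(G) × M(H) → M(G × H)` that are associative, unital and functorial. -/
structure RBCModule (R : Type v) [CommRing R] {Z : GroupClass.{u}} (C : Z.Obj) extends
    BisetFunctor.{u, v, w} R Z where
  mul : ∀ (G H : Z.Obj), RBC R C G →ₗ[R] obj H →ₗ[R] obj (G.prod H)
  mul_assoc : ∀ (G H K : Z.Obj) (a : RBC R C G) (b : RBC R C H) (m : obj K),
    mul (G.prod H) K (RBC.mul R C a b) m =
      map (H := (G.prod H).prod K) (G := G.prod (H.prod K))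
        (RB.of R (Biset.ofEquiv (MulEquiv.prodAssoc : (G × H) × K ≃* G × (H × K)).symm))
        (mul G (H.prod K) a (mul H K b m))
  one_mul : ∀ (G : Z.Obj) (m : obj G),
    m = map (H := G) (G := (GroupClass.Obj.one Z).prod G)
      (RB.of R (Biset.ofEquiv (MulEquiv.uniqueProd : PUnit.{u + 1} × G ≃* G)))
      (mul (GroupClass.Obj.one Z) G (RBC.one R C) m)
  functorial : ∀ {G' G H' H : Z.Obj} (φ : RB R G' G) (ψ : RB R H' H) (a : RBC R C G) (m : obj H),
    map (H := G'.prod H') (G := G.prod H) (RB.prod R φ ψ) (mul G H a m) =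
      mul G' H' (RBC.map R C φ a) (map ψ m)

namespace RBCModule

variable {R : Type v} [CommRing R] {Z : GroupClass.{u}} {C : Z.Obj}

/-- A submodule of an `RB_C`-module: a subfunctor stable under the products with elements of
`RB_C`. -/
structure Sub (M : RBCModule.{u, v, w} R C) where
  sub : ∀ G : Z.Obj, Submodule R (M.obj G)
  map_mem : ∀ {H G : Z.Obj} (φ : RB R H G) (m : M.obj G), m ∈ sub G → M.map φ m ∈ sub H
  mul_mem : ∀ {G H : Z.Obj} (a : RBC R C G) (m : M.obj H), m ∈ sub H →
    M.mul G H a m ∈ sub (G.prod H)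

/-- A simple `RB_C`-module: it is nonzero and its only submodules are `0` and itself. -/
def IsSimple (M : RBCModule.{u, v, w} R C) : Prop :=
  (∃ G : Z.Obj, Nontrivial (M.obj G)) ∧
    ∀ N : M.Sub, (∀ G, N.sub G = ⊥) ∨ (∀ G, N.sub G = ⊤)

end RBCModule

/-! A transitive `(H × K × C)`-set is determined by a point stabiliser `D`. If the projection `P` of
`D` to `H` is proper, the set is induced from `P × K × C`, so it factors through `P`. If `P = H` and
`D` contains some `(h, 1, 1)` with `h ≠ 1`, then `H` acts with a nontrivial kernel `N`, and the set
factors through `H ⧸ N`. The same holds for `K` (`factorsLeftSmaller_or`, for any decomposition `e :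
H × M ≃* G`, so that it serves both factors and both bracketings). If neither factor gives a smaller
group, `D` projects onto `H` and `K` and meets each of them trivially. Because `|C|` is prime and
`|H| = |K|`, either `D` itself or its subgroup with trivial `C`-coordinate is then the graph of an
isomorphism `H ≃* K`, up to the `C`-coordinate (`nonempty_mulEquiv_of_subgroup`). This gives the
first claim.

For the second claim, an element `m` of `S(H)` defines a linear map `act` from `RB(K × H × C)` to
`S(K)`: multiply with `m` and contract the two copies of `H`. If a set factors through `L`, on the
side of `K` or of `H`, its value under `act` passes through `S(L)` (`act_map_left`,
`act_map_right`). Minimal groups have equal order and `S` vanishes on smaller groups, so for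
non-isomorphic minimal `H` and `K` all transitive sets act by zero, and hence `act = 0`
(`act_eq_zero`). The smaller groups are subquotients, which keeps them in the class `𝒵`.

Simplicity contradicts this. The elements whose products are sent to zero by every map into `S(K)`
form a submodule, which is neither everything nor zero, so some `S(φ)(a × x)` with `x` in `S(H)` is
nonzero in `S(K)` (`IsSimple.exists_map_mul_ne_zero`). For a biset `φ`, every such element is a
value of `act` (`map_mul_eq_act`). -/

/-! ### Left factorisations of a `G`-set along `G ≃ H × M` -/

/-- The `G`-set `X`, where `G ≃ H × M`, is isomorphic to `U ×_L Z` for an `(H, L)`-biset `U` and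
an `(L × M)`-set `Z`; the isomorphism is given by a map `U × Z → X`. -/
def FactorsLeft {G H M : Type u} [Group G] [Group H] [Group M] (e : H × M ≃* G)
    (X : Type u) [MulAction G X] (L : Type u) [Group L] : Prop :=
  ∃ (U : Biset H L) (Z : Type u) (_ : Finite Z) (_ : MulAction (L × M) Z)
    (f : U.carrier → Z → X),
    (∀ h u z, f (h • u) z = e (h, 1) • f u z) ∧
    (∀ m u z, f u (((1, m) : L × M) • z) = e (1, m) • f u z) ∧
    (∀ l u z, f (op l • u) z = f u (((l, 1) : L × M) • z)) ∧
    (∀ x, ∃ u z, f u z = x) ∧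
    ∀ u z u' z', f u z = f u' z' → ∃ l : L, u' = op l • u ∧ z' = ((l⁻¹, 1) : L × M) • z

/-- The `G`-set `X` factors on the left through a subquotient of `H` of smaller order. -/
def FactorsLeftSmaller {G H M : Type u} [Group G] [Group H] [Group M] (e : H × M ≃* G)
    (X : Type u) [MulAction G X] : Prop :=
  ∃ (L : Type u) (_ : Group L) (D : Subgroup H) (π : D →* L),
    Function.Surjective π ∧ Nat.card L < Nat.card H ∧ FactorsLeft e X L

section Factor

variable {G H M : Type u} [Group G] [Group H] [Group M] (e : H × M ≃* G)
  {X : Type u} [MulAction G X]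

/-- Induction in stages: the stabiliser of `x₀` lies in `P × M`, where `P` is its projection to `H`.
Hence `X` is `H ×_P Z`, with `Z` the `(P × M)`-orbit of `x₀`, and `h₀` shows that `P` is proper. -/
theorem factorsLeftSmaller_of_proj_ne_top [Finite H] [Finite X]
    [MulAction.IsPretransitive G X] (x₀ : X) (h₀ : H) (hh : ∀ m, e (h₀, m) • x₀ ≠ x₀) :
    FactorsLeftSmaller e X := by
  let P : Subgroup H :=
    ((MulAction.stabilizer G x₀).comap e.toMonoidHom).map (MonoidHom.fst H M)
  have hP : ∀ h, h ∈ P ↔ ∃ m, e (h, m) • x₀ = x₀ := by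
    intro h
    simp [P, Subgroup.mem_map, MulAction.mem_stabilizer_iff]
  have hne : P ≠ ⊤ := fun h => by
    obtain ⟨m, hm⟩ := (hP h₀).1 (h ▸ Subgroup.mem_top h₀)
    exact hh m hm
  refine ⟨P, inferInstance, P, MonoidHom.id P, Function.surjective_id, ?_, ?_⟩
  · exact lt_of_le_of_ne (Subgroup.card_le_card_group P)
      fun h => hne (Subgroup.eq_top_of_card_eq P h)
  let i : P × M →* G := e.toMonoidHom.comp (MonoidHom.prodMap P.subtype (MonoidHom.id M))
  have hi : ∀ l m, i (l, m) = e ((l : H), m) := fun _ _ => rfl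
  let _ : MulAction (P × M) X := MulAction.compHom X i
  have hs : ∀ (g : P × M) (x : X), g • x = i g • x := fun _ _ => rfl
  let U : Biset H P :=
    { carrier := H
      right := MulAction.compHom H (Subgroup.subtype P).op
      comm := @SMulCommClass.mk _ _ _ (_) (_) fun h g x => (mul_assoc h x (g.unop : H)).symm }
  refine ⟨U, MulAction.orbit (P × M) x₀, inferInstance, inferInstance,
    fun (u : H) z => e (u, 1) • (z : X), ?_, ?_, ?_, ?_, ?_⟩
  · intro h u z
    rw [smul_smul, ← map_mul]
    simp only [Prod.mk_mul_mk, mul_one]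
    rfl
  · intro m u z
    change e ((u : H), 1) • (((1, m) : P × M) • (z : X)) = e (1, m) • e ((u : H), 1) • (z : X)
    rw [hs, hi, smul_smul, smul_smul, ← map_mul, ← map_mul]
    simp
  · intro l u z
    change e ((u : H) * l, 1) • (z : X) = e ((u : H), 1) • (((l, 1) : P × M) • (z : X))
    rw [hs, hi, smul_smul, ← map_mul, Prod.mk_mul_mk, mul_one]
  · intro x
    obtain ⟨g, rfl⟩ := MulAction.exists_smul_eq G x₀ x
    obtain ⟨⟨h, m⟩, rfl⟩ := e.surjective g
    refine ⟨h, ⟨_, MulAction.mem_orbit x₀ ((1, m) : P × M)⟩, ?_⟩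
    change e (h, 1) • (((1, m) : P × M) • x₀) = e (h, m) • x₀
    rw [hs, hi, smul_smul, ← map_mul]
    simp
  · rintro u ⟨_, ⟨⟨l, m⟩, rfl⟩⟩ u' ⟨_, ⟨⟨l', m'⟩, rfl⟩⟩ h
    change H at u u'
    simp only [hs, hi, smul_smul, ← map_mul, Prod.mk_mul_mk, one_mul] at h
    -- Equal images differ by an element of the stabiliser, so its `H`-component `l⁻¹ u⁻¹ u' l'`
    -- lies in `P`; now cancel `l` and `l'`.
    have hmem : u⁻¹ * u' ∈ P := by
      have : (l : H)⁻¹ * u⁻¹ * u' * l' ∈ P := by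
        refine (hP _).2 ⟨m⁻¹ * m', ?_⟩
        have h2 := congrArg (fun x => e (u * l, m)⁻¹ • x) h.symm
        simp only [smul_smul, ← map_mul] at h2
        simpa [mul_assoc, show e (1, 1) = 1 from map_one e] using h2
      have h3 := P.mul_mem (P.mul_mem l.2 this) (P.inv_mem l'.2)
      simpa [mul_assoc] using h3
    refine ⟨⟨u⁻¹ * u', hmem⟩, (mul_inv_cancel_left u u').symm, ?_⟩
    apply Subtype.ext
    rw [MulAction.orbit.coe_smul]
    simp only [hs, hi]
    rw [smul_smul, ← map_mul]
    have h2 := congrArg (fun x => e (u', 1)⁻¹ • x) h.symm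
    simp only [smul_smul, ← map_mul] at h2
    simpa [mul_assoc] using h2

/-- The action of `H` descends to `H ⧸ N`, where `N` is its kernel. So `X` is `(H ⧸ N) ×_{H ⧸ N} X`,
which is inflation along `H → H ⧸ N`. -/
theorem factorsLeftSmaller_of_kernel [Finite H] [Finite X]
    (h₀ : H) (h1 : h₀ ≠ 1) (hh : ∀ x : X, e (h₀, 1) • x = x) :
    FactorsLeftSmaller e X := by
  let j : H →* Equiv.Perm X :=
    (MulAction.toPermHom G X).comp (e.toMonoidHom.comp (MonoidHom.inl H M))
  let N : Subgroup H := j.ker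
  have hN : N ≠ ⊥ := fun h => h1 <| by
    have : h₀ ∈ N := MonoidHom.mem_ker.2 (Equiv.ext hh)
    rwa [h, Subgroup.mem_bot] at this
  refine ⟨H ⧸ N, inferInstance, ⊤, (QuotientGroup.mk' N).comp (Subgroup.subtype ⊤), ?_, ?_, ?_⟩
  · intro x
    obtain ⟨h, rfl⟩ := QuotientGroup.mk'_surjective N x
    exact ⟨⟨h, trivial⟩, rfl⟩
  · have h2 := Subgroup.card_eq_card_quotient_mul_card_subgroup N
    have h3 : 1 < Nat.card N := (Subgroup.one_lt_card_iff_ne_bot N).2 hN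
    have h4 : 0 < Nat.card (H ⧸ N) := Nat.card_pos
    rw [h2]
    exact lt_mul_of_one_lt_right h4 h3
  let q : H ⧸ N →* Equiv.Perm X := QuotientGroup.kerLift j
  have hq : ∀ h x, q (QuotientGroup.mk h) x = e (h, 1) • x := fun _ _ => rfl
  have hcomm : ∀ a (m : M) x, q a (e (1, m) • x) = e (1, m) • q a x := by
    intro a m x
    obtain ⟨h, rfl⟩ := QuotientGroup.mk_surjective a
    rw [hq, hq, smul_smul, smul_smul, ← map_mul, ← map_mul]
    simp
  let _ : MulAction ((H ⧸ N) × M) X :=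
    { smul := fun g x => q g.1 (e (1, g.2) • x)
      one_smul := fun x => by
        change q 1 (e 1 • x) = x
        simp
      mul_smul := fun a b x => by
        change q (a.1 * b.1) (e (1, a.2 * b.2) • x) = q a.1 (e (1, a.2) • q b.1 (e (1, b.2) • x))
        rw [← hcomm, smul_smul, ← map_mul, map_mul q, Equiv.Perm.mul_apply]
        simp }
  have hs : ∀ (g : (H ⧸ N) × M) (x : X), g • x = q g.1 (e (1, g.2) • x) := fun _ _ => rfl
  let U : Biset H (H ⧸ N) :=
    { carrier := H ⧸ N
      left := MulAction.compHom (H ⧸ N) (QuotientGroup.mk' N)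
      right := Monoid.toOppositeMulAction
      comm := @SMulCommClass.mk _ _ _ (_) (_) fun h g x =>
        (mul_assoc (QuotientGroup.mk' N h) x g.unop).symm }
  refine ⟨U, X, inferInstance, inferInstance, fun u z => q u z, ?_, ?_, ?_, ?_, ?_⟩
  · intro h u z
    change q (QuotientGroup.mk h * u) z = _
    rw [map_mul, Equiv.Perm.mul_apply, hq]
  · intro m u z
    change q u (((1, m) : (H ⧸ N) × M) • z) = e (1, m) • q u z
    rw [hs, map_one, Equiv.Perm.one_apply, hcomm]
  · intro l u z
    change q (u * l) z = _
    rw [hs, map_mul, Equiv.Perm.mul_apply]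
    change _ = q u (q l (e 1 • z))
    simp
  · intro x
    exact ⟨(1 : H ⧸ N), x, by simp⟩
  · intro u z u' z' h
    change H ⧸ N at u u'
    change q u z = q u' z' at h
    refine ⟨u⁻¹ * u', (mul_inv_cancel_left u u').symm, ?_⟩
    rw [hs]
    change _ = q (u⁻¹ * u')⁻¹ (e 1 • z)
    rw [mul_inv_rev, map_mul, Equiv.Perm.mul_apply, map_one, one_smul, inv_inv, h, map_inv]
    exact ((q u').symm_apply_apply z').symm

theorem factorsLeftSmaller_or [Finite H] [Finite X] [MulAction.IsPretransitive G X] (x₀ : X) :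
    FactorsLeftSmaller e X ∨
      (∀ h, ∃ m, e (h, m) • x₀ = x₀) ∧ ∀ h, e (h, 1) • x₀ = x₀ → h = 1 := by
  by_cases h₁ : ∀ h, ∃ m, e (h, m) • x₀ = x₀
  · by_cases h₂ : ∀ h, e (h, 1) • x₀ = x₀ → h = 1
    · exact Or.inr ⟨h₁, h₂⟩
    · push Not at h₂
      obtain ⟨n, hn, hn1⟩ := h₂
      refine Or.inl (factorsLeftSmaller_of_kernel e n hn1 fun x => ?_)
      obtain ⟨g, rfl⟩ := MulAction.exists_smul_eq G x₀ x
      obtain ⟨⟨h, m⟩, rfl⟩ := e.surjective g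
      obtain ⟨m', hm'⟩ := h₁ h
      -- Since the stabiliser projects onto `H`, the factor `M` alone is transitive on `X`. An `(n,
      -- 1)` fixing `x₀` commutes with `M` and therefore fixes every point.
      have hx : e (h, m) • x₀ = e (1, m * m'⁻¹) • x₀ := by
        conv_rhs => rw [← hm']
        rw [smul_smul, ← map_mul]
        simp
      rw [hx, smul_smul, ← map_mul]
      have : ((n, 1) : H × M) * (1, m * m'⁻¹) = (1, m * m'⁻¹) * (n, 1) := by simp
      rw [this, map_mul, mul_smul, hn]
  · push Not at h₁
    obtain ⟨h, hh⟩ := h₁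
    exact Or.inl (factorsLeftSmaller_of_proj_ne_top e x₀ h hh)

end Factor

/-! ### Subgroups of `H × K × C` with `C` of prime order -/

theorem nonempty_mulEquiv_of_subgroup {H K C : Type*} [Group H] [Group K] [Group C]
    [Finite H] [Finite K] (hC : (Nat.card C).Prime) (hHK : Nat.card H = Nat.card K)
    (D : Subgroup (H × K × C)) (hp₁ : ∀ h, ∃ k c, (h, k, c) ∈ D) (hp₂ : ∀ k, ∃ h c, (h, k, c) ∈ D)
    (hk₁ : ∀ h, (h, 1, 1) ∈ D → h = 1) (hk₂ : ∀ k, (1, k, 1) ∈ D → k = 1) :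
    Nonempty (H ≃* K) := by
  have : Finite C := Nat.finite_of_card_ne_zero hC.ne_zero
  -- `E` is isomorphic to `H` by projection, so `|E| = |K|`, and the projection to `K` is bijective
  -- as soon as it is surjective or injective.
  have key : ∀ E : Subgroup (H × K × C), (∀ h, ∃ k c, (h, k, c) ∈ E) →
      (∀ k c, (1, k, c) ∈ E → k = 1 ∧ c = 1) →
      ((∀ k, ∃ h c, (h, k, c) ∈ E) ∨ (∀ h c, (h, 1, c) ∈ E → h = 1 ∧ c = 1)) →
      Nonempty (H ≃* K) := by
    intro E h₁ h₂ h₃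
    let f : E →* H := (MonoidHom.fst H (K × C)).comp E.subtype
    let g : E →* K := (MonoidHom.fst K C).comp ((MonoidHom.snd H (K × C)).comp E.subtype)
    have hf : Function.Bijective f := by
      refine ⟨(injective_iff_map_eq_one f).2 ?_, fun h => ?_⟩
      · rintro ⟨⟨h, k, c⟩, hm⟩ (rfl : h = 1)
        obtain ⟨rfl, rfl⟩ := h₂ k c hm
        rfl
      · obtain ⟨k, c, hm⟩ := h₁ h
        exact ⟨⟨_, hm⟩, rfl⟩
    have hcard : Nat.card E = Nat.card K := (Nat.card_eq_of_bijective f hf).trans hHK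
    have hg : Function.Bijective g := by
      rcases h₃ with h₃ | h₃
      · refine (Nat.bijective_iff_surjective_and_card g).2 ⟨fun k => ?_, hcard⟩
        obtain ⟨h, c, hm⟩ := h₃ k
        exact ⟨⟨_, hm⟩, rfl⟩
      · refine (Nat.bijective_iff_injective_and_card g).2
          ⟨(injective_iff_map_eq_one g).2 ?_, hcard⟩
        rintro ⟨⟨h, k, c⟩, hm⟩ (rfl : k = 1)
        obtain ⟨rfl, rfl⟩ := h₃ h c hm
        rfl
    exact ⟨(MulEquiv.ofBijective f hf).symm.trans (MulEquiv.ofBijective g hg)⟩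
  -- The third coordinates of the elements `(1, k, c)` of `D` form a subgroup of `C`, which is
  -- trivial or all of `C`. If it is trivial, `D` projects injectively to `H`.
  by_cases hN : ∀ k c, (1, k, c) ∈ D → c = 1
  · refine key D hp₁ (fun k c hm => ?_) (Or.inl hp₂)
    obtain rfl := hN k c hm
    exact ⟨hk₂ k hm, rfl⟩
  · push Not at hN
    obtain ⟨k₀, c₀, hm₀, hc₀⟩ := hN
    have hgen : ∀ c, ∃ k, ((1, k, c) : H × K × C) ∈ D := by
      intro c
      have : Fact (Nat.card C).Prime := ⟨hC⟩
      obtain ⟨i, rfl⟩ := mem_powers_of_prime_card (p := Nat.card C) rfl hc₀ (g' := c)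
      exact ⟨k₀ ^ i, by simpa using D.pow_mem hm₀ i⟩
    -- Multiplying by some `(1, k', c⁻¹)` in `D` makes the `C`-coordinate trivial without changing
    -- `h`, so this smaller subgroup still projects onto `H`. Surjectivity onto `K` is replaced by
    -- injectivity.
    refine key (D ⊓ Subgroup.comap ((MonoidHom.snd K C).comp (MonoidHom.snd H (K × C))) ⊥)
      (fun h => ?_) (fun k c hm => ?_) (Or.inr fun h c hm => ?_)
    · obtain ⟨k, c, hm⟩ := hp₁ h
      obtain ⟨k', hk'⟩ := hgen c⁻¹
      exact ⟨k * k', 1, by simpa using D.mul_mem hm hk', by simp⟩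
    · have : c = 1 := hm.2
      subst this
      exact ⟨hk₂ k hm.1, rfl⟩
    · have : c = 1 := hm.2
      subst this
      exact ⟨hk₁ h hm.1, rfl⟩

/-- The isomorphism exchanging the first two factors of `H × K × C`. -/
def MulEquiv.prodLeftComm (K H C : Type*) [Group H] [Group K] [Group C] :
    K × H × C ≃* H × K × C where
  toFun g := (g.2.1, g.1, g.2.2)
  invFun g := (g.2.1, g.1, g.2.2)
  left_inv _ := rfl
  right_inv _ := rfl
  map_mul' _ _ := rfl

theorem nonempty_mulEquiv_or_factorsLeftSmaller {G H K C : Type u} [Group G] [Group H] [Group K]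
    [Group C] [Finite H] [Finite K] (hC : (Nat.card C).Prime) (hHK : Nat.card H = Nat.card K)
    (e : H × K × C ≃* G) (X : Type u) [MulAction G X] [Finite X]
    [MulAction.IsPretransitive G X] [Nonempty X] :
    Nonempty (H ≃* K) ∨ FactorsLeftSmaller e X ∨
      FactorsLeftSmaller ((MulEquiv.prodLeftComm K H C).trans e) X := by
  obtain ⟨x₀⟩ := ‹Nonempty X›
  rcases factorsLeftSmaller_or e x₀ with h | ⟨hp₁, hk₁⟩
  · exact Or.inr (Or.inl h)
  rcases factorsLeftSmaller_or ((MulEquiv.prodLeftComm K H C).trans e) x₀ with h | ⟨hp₂, hk₂⟩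
  · exact Or.inr (Or.inr h)
  refine Or.inl (nonempty_mulEquiv_of_subgroup hC hHK
    ((MulAction.stabilizer G x₀).comap e.toMonoidHom) ?_ ?_ hk₁ hk₂)
  · intro h
    obtain ⟨⟨k, c⟩, hm⟩ := hp₁ h
    exact ⟨k, c, hm⟩
  · intro k
    obtain ⟨⟨h, c⟩, hm⟩ := hp₂ k
    exact ⟨h, c, hm⟩

/-! ### From left factorisations to factorisations `Y ×ᵈ_L Z` -/

section FactorsThrough

variable {H K C X L : Type u} [Group H] [Group K] [Group C] [Group L] [MulAction (H × K × C) X]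

theorem FactorsThrough.of_factorsLeft (h : FactorsLeft (MulEquiv.refl (H × K × C)) X L) :
    FactorsThrough H K C X L := by
  obtain ⟨U, Z, hZ, actZ, f, h₁, h₂, h₃, h₄, h₅⟩ := h
  -- `C` acts trivially on `U`; its action on `X` is carried entirely by `Z`.
  let _ : MulAction (H × L × C) U.carrier :=
    { smul := fun g u => g.1 • op g.2.1⁻¹ • u
      one_smul := fun u => by
        change (1 : H) • op (1 : L)⁻¹ • u = u
        simp
      mul_smul := fun a b u => by
        change (a.1 * b.1) • op (a.2.1 * b.2.1)⁻¹ • u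
          = a.1 • op a.2.1⁻¹ • b.1 • op b.2.1⁻¹ • u
        simp [mul_smul, smul_comm] }
  have hs : ∀ (g : H × L × C) (u : U.carrier), g • u = g.1 • op g.2.1⁻¹ • u := fun _ _ => rfl
  let F : DiagComp H L K C U.carrier Z → X :=
    Quotient.lift (s := diagSetoid H L K C U.carrier Z) (fun p => f p.1 p.2) (by
      rintro p q ⟨l, rfl⟩
      simp only [hs, one_smul]
      rw [h₃, smul_smul]
      congr 1
      change _ = ((l⁻¹ * l, 1 * 1) : L × K × C) • p.2
      rw [inv_mul_cancel, one_mul]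
      exact (one_smul (L × K × C) p.2).symm)
  have hF : Function.Bijective F := by
    refine ⟨fun p q => ?_, fun x => ?_⟩
    · induction p using Quotient.inductionOn with | h p => ?_
      induction q using Quotient.inductionOn with | h q => ?_
      intro h
      obtain ⟨l, hl₁, hl₂⟩ := h₅ _ _ _ _ h
      -- The inverse appears because `l` acts on `U` from the left as `l⁻¹` does from the right.
      refine Quotient.sound (s := diagSetoid H L K C U.carrier Z) ⟨l⁻¹, Prod.ext ?_ ?_⟩
      · simpa [hs] using hl₁
      · exact hl₂
    · obtain ⟨u, z, h⟩ := h₄ x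
      exact ⟨Quotient.mk (diagSetoid H L K C U.carrier Z) (u, z), h⟩
  refine ⟨U.carrier, Z, inferInstance, hZ, inferInstance, actZ, (Equiv.ofBijective F hF).symm, ?_⟩
  intro g x
  rw [Equiv.symm_apply_eq]
  obtain ⟨p, rfl⟩ := (Equiv.ofBijective F hF).surjective x
  rw [Equiv.symm_apply_apply]
  induction p using Quotient.inductionOn with | h p => ?_
  obtain ⟨h, k, c⟩ := g
  change _ = f (((h, 1, c) : H × L × C) • p.1) (((1, k, c) : L × K × C) • p.2)
  rw [hs, h₁, h₂]
  change _ • f p.1 p.2 = _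
  simp [smul_smul]

/-- Splitting off `K` instead of `H` makes the biset the second factor of `×ᵈ_L`, so the roles of
`U` and `Z` are exchanged. -/
theorem FactorsThrough.of_factorsLeft_swap
    (h : FactorsLeft (MulEquiv.prodLeftComm K H C) X L) :
    FactorsThrough H K C X L := by
  obtain ⟨U, Z, hZ, actZ, f, h₁, h₂, h₃, h₄, h₅⟩ := h
  let _ : MulAction (L × K × C) U.carrier :=
    { smul := fun g u => g.2.1 • op g.1⁻¹ • u
      one_smul := fun u => by
        change (1 : K) • op (1 : L)⁻¹ • u = u
        simp
      mul_smul := fun a b u => by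
        change (a.2.1 * b.2.1) • op (a.1 * b.1)⁻¹ • u
          = a.2.1 • op a.1⁻¹ • b.2.1 • op b.1⁻¹ • u
        simp [mul_smul, smul_comm] }
  have hs : ∀ (g : L × K × C) (u : U.carrier), g • u = g.2.1 • op g.1⁻¹ • u := fun _ _ => rfl
  let _ : MulAction (H × L × C) Z :=
    MulAction.compHom Z (MulEquiv.prodLeftComm H L C).toMonoidHom
  have hs' : ∀ (g : H × L × C) (z : Z), g • z = ((g.2.1, g.1, g.2.2) : L × H × C) • z :=
    fun _ _ => rfl
  let F : DiagComp H L K C Z U.carrier → X :=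
    Quotient.lift (s := diagSetoid H L K C Z U.carrier) (fun p => f p.2 p.1) (by
      rintro p q ⟨l, rfl⟩
      simp only [hs, hs', one_smul]
      rw [h₃, smul_smul]
      congr 1
      change _ = ((l⁻¹ * l, 1 * 1) : L × H × C) • p.1
      rw [inv_mul_cancel, one_mul]
      exact (one_smul (L × H × C) p.1).symm)
  have hF : Function.Bijective F := by
    refine ⟨fun p q => ?_, fun x => ?_⟩
    · induction p using Quotient.inductionOn with | h p => ?_
      induction q using Quotient.inductionOn with | h q => ?_
      intro h
      obtain ⟨l, hl₁, hl₂⟩ := h₅ _ _ _ _ h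
      refine Quotient.sound (s := diagSetoid H L K C Z U.carrier) ⟨l⁻¹, Prod.ext ?_ ?_⟩
      · exact hl₂
      · simpa [hs] using hl₁
    · obtain ⟨u, z, h⟩ := h₄ x
      exact ⟨Quotient.mk (diagSetoid H L K C Z U.carrier) (z, u), h⟩
  refine ⟨Z, U.carrier, hZ, inferInstance, inferInstance, inferInstance,
    (Equiv.ofBijective F hF).symm, ?_⟩
  intro g x
  rw [Equiv.symm_apply_eq]
  obtain ⟨p, rfl⟩ := (Equiv.ofBijective F hF).surjective x
  rw [Equiv.symm_apply_apply]
  induction p using Quotient.inductionOn with | h p => ?_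
  obtain ⟨h, k, c⟩ := g
  change _ = f (((1, k, c) : L × K × C) • p.2) (((h, 1, c) : H × L × C) • p.1)
  rw [hs, hs', h₁, h₂]
  change _ • f p.2 p.1 = _
  rw [smul_smul]
  simp [MulEquiv.prodLeftComm]

end FactorsThrough

/-! ### Composites of bisets and contraction -/

namespace Biset

variable {H G H' G' K L P : Type u} [Group H] [Group G] [Group H'] [Group G'] [Group K] [Group L]
  [Group P]

theorem Iso.symm {U V : Biset H G} (h : U.Iso V) : V.Iso U := by
  obtain ⟨e, h₁, h₂⟩ := h
  exact ⟨e.symm, fun h u => by rw [Equiv.symm_apply_eq]; simp [h₁],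
    fun h u => by rw [Equiv.symm_apply_eq]; simp [h₂]⟩

theorem Iso.trans {U V W : Biset H G} (h : U.Iso V) (h' : V.Iso W) : U.Iso W := by
  obtain ⟨e, h₁, h₂⟩ := h
  obtain ⟨e', h₁', h₂'⟩ := h'
  exact ⟨e.trans e', fun h u => by simp [h₁, h₁'], fun h u => by simp [h₂, h₂']⟩

/-- A criterion for `V ×_H U ≅ W`. -/
theorem comp_iso_of_bijective {V : Biset K H} {U : Biset H G} {W : Biset K G}
    (f : V.carrier → U.carrier → W.carrier)
    (hl : ∀ (k : K) v u, f (k • v) u = k • f v u)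
    (hr : ∀ (g : G) v u, f v (op g • u) = op g • f v u)
    (hm : ∀ (h : H) v u, f (op h • v) u = f v (h • u))
    (hs : ∀ w, ∃ v u, f v u = w)
    (hi : ∀ v u v' u', f v u = f v' u' → ∃ h : H, v' = op h • v ∧ u' = h⁻¹ • u) :
    (V.comp U).Iso W := by
  let F : (V.comp U).carrier → W.carrier :=
    Quotient.lift (s := compSetoid V U) (fun p => f p.1 p.2) (by
      rintro p q ⟨h, rfl⟩
      simp [hm])
  have hF : Function.Bijective F := by
    refine ⟨fun p q => ?_, fun x => ?_⟩
    · induction p using Quotient.inductionOn with | h p => ?_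
      induction q using Quotient.inductionOn with | h q => ?_
      intro h
      obtain ⟨l, hl₁, hl₂⟩ := hi _ _ _ _ h
      exact Quotient.sound (s := compSetoid V U) ⟨l, Prod.ext hl₁ hl₂⟩
    · obtain ⟨u, z, h⟩ := hs x
      exact ⟨Quotient.mk (compSetoid V U) (u, z), h⟩
  refine ⟨Equiv.ofBijective F hF, fun k p => ?_, fun g p => ?_⟩
  · induction p using Quotient.inductionOn with | h p => exact hl k p.1 p.2
  · induction p using Quotient.inductionOn with | h p => exact hr g p.1 p.2

/-- A criterion for `V ×_H U ≅ W` in terms of a system of representatives of the orbits. -/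
theorem comp_iso_of_section {V : Biset K H} {U : Biset H G} {W : Biset K G}
    (f : V.carrier → U.carrier → W.carrier) (s : W.carrier → V.carrier × U.carrier)
    (hl : ∀ (k : K) v u, f (k • v) u = k • f v u)
    (hr : ∀ (g : G) v u, f v (op g • u) = op g • f v u)
    (hm : ∀ (h : H) v u, f (op h • v) u = f v (h • u))
    (hs : ∀ w, f (s w).1 (s w).2 = w)
    (hi : ∀ v u, ∃ h : H, op h • v = (s (f v u)).1 ∧ u = h • (s (f v u)).2) :
    (V.comp U).Iso W := by
  refine comp_iso_of_bijective f hl hr hm (fun w => ⟨_, _, hs w⟩) fun v u v' u' h => ?_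
  obtain ⟨a, ha₁, ha₂⟩ := hi v u
  obtain ⟨b, hb₁, hb₂⟩ := hi v' u'
  refine ⟨a * b⁻¹, ?_, ?_⟩
  · rw [MulOpposite.op_mul, mul_smul, ha₁, h, ← hb₁, smul_smul, ← MulOpposite.op_mul]
    simp
  · rw [hb₂, ← h, mul_inv_rev, inv_inv, mul_smul, eq_inv_smul_iff.2 ha₂.symm]

theorem op_smul_comm (U : Biset H G) (g : G) (h : H) (u : U.carrier) :
    op g • h • u = h • op g • u :=
  (smul_comm h (op g) u).symm

theorem op_smul_op (U : Biset H G) (g g' : G) (u : U.carrier) :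
    op g • op g' • u = op (g' * g) • u := by
  rw [smul_smul, ← MulOpposite.op_mul]

theorem op_smul_of_eq_one (U : Biset H G) {g : G} (hg : g = 1) (u : U.carrier) :
    op g • u = u := by
  rw [hg, MulOpposite.op_one, one_smul]

theorem id_comp [Finite H] (U : Biset H G) : ((Biset.id H).comp U).Iso U := by
  refine comp_iso_of_section (fun (h : H) u => h • u) (fun u => ((1 : H), u)) ?_ ?_ ?_ ?_ ?_
  · exact fun k v u => mul_smul (k : H) v u
  · exact fun g (v : H) u => smul_comm v (op g) u
  · exact fun h (v : H) u => mul_smul v h u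
  · exact fun w => one_smul H w
  · exact fun (v : H) u => ⟨v⁻¹, mul_inv_cancel v, (inv_smul_smul v u).symm⟩

theorem id_prod_id [Finite H] [Finite H'] :
    ((Biset.id H).prod (Biset.id H')).Iso (Biset.id (H × H')) :=
  ⟨Equiv.refl _, fun _ _ => rfl, fun _ _ => rfl⟩

theorem ofEquiv_symm_comp_ofEquiv [Finite H] [Finite G] (f : G ≃* H) :
    ((ofEquiv f.symm).comp (ofEquiv f)).Iso (Biset.id G) := by
  refine comp_iso_of_section (fun (x : G) (y : H) => (x * f.symm y : G))
    (fun (x : G) => (x, (1 : H))) ?_ ?_ ?_ ?_ ?_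
  · exact fun k (v : G) (u : H) => mul_assoc k v _
  · intro g (v : G) (u : H)
    change v * f.symm (u * f g) = v * f.symm u * g
    simp [mul_assoc]
  · intro h (v : G) (u : H)
    change v * f.symm h * f.symm u = v * f.symm (h * u)
    simp [mul_assoc]
  · intro (w : G)
    change w * f.symm 1 = w
    simp
  · intro (v : G) (u : H)
    refine ⟨u, rfl, ?_⟩
    exact (mul_one u).symm

/-- The `(K, (K × H) × H)`-biset `K × H` that contracts the last two arguments. -/
def contr (K H : Type u) [Group K] [Group H] [Finite K] [Finite H] : Biset K ((K × H) × H) where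
  carrier := K × H
  left :=
    { smul := fun k x => (k * x.1, x.2)
      one_smul := fun x => Prod.ext (_root_.one_mul x.1) rfl
      mul_smul := fun a b x => Prod.ext (_root_.mul_assoc a b x.1) rfl }
  right :=
    { smul := fun g x => (x.1 * g.unop.1.1, g.unop.1.2⁻¹ * x.2 * g.unop.2)
      one_smul := fun x => by
        change (x.1 * 1, 1⁻¹ * x.2 * 1) = x
        simp
      mul_smul := fun a b x => by
        change (x.1 * (b.unop.1.1 * a.unop.1.1),
          (b.unop.1.2 * a.unop.1.2)⁻¹ * x.2 * (b.unop.2 * a.unop.2)) =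
          (x.1 * b.unop.1.1 * a.unop.1.1,
            a.unop.1.2⁻¹ * (b.unop.1.2⁻¹ * x.2 * b.unop.2) * a.unop.2)
        simp [mul_assoc] }
  comm := @SMulCommClass.mk _ _ _ (_) (_) fun k g x =>
    Prod.ext (_root_.mul_assoc k x.1 g.unop.1.1).symm rfl

/-- A `(K, P × H)`-biset as a `(K × H, P)`-biset. -/
def shift (U : Biset K (P × H)) : Biset (K × H) P where
  carrier := U.carrier
  left :=
    { smul := fun g u => g.1 • op ((1, g.2⁻¹) : P × H) • u
      one_smul := fun u => by
        change (1 : K) • op ((1, 1⁻¹) : P × H) • u = u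
        rw [one_smul, op_smul_of_eq_one]
        simp
      mul_smul := fun a b u => by
        change (a.1 * b.1) • op ((1, (a.2 * b.2)⁻¹) : P × H) • u =
          a.1 • op ((1, a.2⁻¹) : P × H) • b.1 • op ((1, b.2⁻¹) : P × H) • u
        simp [op_smul_comm, op_smul_op, mul_smul] }
  right :=
    { smul := fun g u => op ((g.unop, 1) : P × H) • u
      one_smul := fun u => one_smul _ u
      mul_smul := fun a b u => by
        change op ((b.unop * a.unop, 1) : P × H) • u =
          op ((a.unop, 1) : P × H) • op ((b.unop, 1) : P × H) • u
        simp [op_smul_op] }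
  comm := @SMulCommClass.mk _ _ _ (_) (_) fun g p u => by
    change g.1 • op ((1, g.2⁻¹) : P × H) • op ((p.unop, 1) : P × H) • u =
      op ((p.unop, 1) : P × H) • g.1 • op ((1, g.2⁻¹) : P × H) • u
    simp [op_smul_op, op_smul_comm]

/-- A snake identity: moving `H` from the right to the left and then contracting it restores `U`. -/
theorem contr_comp_shift_prod [Finite K] [Finite H] (U : Biset K (P × H)) :
    ((contr K H).comp (U.shift.prod (Biset.id H))).Iso U := by
  let f : K × H → U.carrier × H → U.carrier := fun x y => x.1 • op ((1, x.2 * y.2) : P × H) • y.1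
  let s : U.carrier → (K × H) × (U.carrier × H) := fun u => ((1, 1), (u, 1))
  refine comp_iso_of_section (U := U.shift.prod (Biset.id H)) f s ?_ ?_ ?_ ?_ ?_
  · exact fun k (x : K × H) (y : U.carrier × H) => mul_smul k x.1 _
  · rintro ⟨p, h⟩ (⟨x, a⟩ : K × H) (⟨u, b⟩ : U.carrier × H)
    change x • op ((1, a * (b * h)) : P × H) • op ((p, 1) : P × H) • u =
      op ((p, h) : P × H) • x • op ((1, a * b) : P × H) • u
    simp [op_smul_op, op_smul_comm, mul_assoc]
  · rintro ⟨⟨k, h⟩, h'⟩ (⟨x, a⟩ : K × H) (⟨u, b⟩ : U.carrier × H)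
    change (x * k) • op ((1, (h⁻¹ * a * h') * b) : P × H) • u =
      x • op ((1, a * (h' * b)) : P × H) • k • op ((1, h⁻¹) : P × H) • u
    simp [op_smul_op, op_smul_comm, mul_assoc, mul_smul]
  · intro u
    change (1 : K) • op ((1, 1 * 1) : P × H) • u = u
    rw [one_smul, op_smul_of_eq_one]
    simp
  · rintro (⟨x, a⟩ : K × H) (⟨u, b⟩ : U.carrier × H)
    refine ⟨((x⁻¹, a * b), b), ?_, ?_⟩
    · change (x * x⁻¹, (a * b)⁻¹ * a * b) = ((1, 1) : K × H)
      simp [mul_assoc]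
    · change (u, b) = (x⁻¹ • op ((1, (a * b)⁻¹) : P × H) • x • op ((1, a * b) : P × H) • u, b * 1)
      rw [op_smul_comm, op_smul_op, inv_smul_smul, op_smul_of_eq_one, mul_one]
      simp

/-- For a `(K, L)`-biset `U`, the `(K, (L × H) × H)`-biset `U × H`. -/
def contrLeft (U : Biset K L) (H : Type u) [Group H] [Finite H] : Biset K ((L × H) × H) where
  carrier := U.carrier × H
  left :=
    { smul := fun k x => (k • x.1, x.2)
      one_smul := fun x => Prod.ext (one_smul K x.1) rfl
      mul_smul := fun a b x => Prod.ext (mul_smul a b x.1) rfl }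
  right :=
    { smul := fun g x => (op g.unop.1.1 • x.1, g.unop.1.2⁻¹ * x.2 * g.unop.2)
      one_smul := fun x => by
        change (op (1 : L) • x.1, 1⁻¹ * x.2 * 1) = x
        simp
      mul_smul := fun a b x => by
        change (op (b.unop.1.1 * a.unop.1.1) • x.1,
          (b.unop.1.2 * a.unop.1.2)⁻¹ * x.2 * (b.unop.2 * a.unop.2)) =
          (op a.unop.1.1 • op b.unop.1.1 • x.1,
            a.unop.1.2⁻¹ * (b.unop.1.2⁻¹ * x.2 * b.unop.2) * a.unop.2)
        simp [mul_assoc, op_smul_op] }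
  comm := @SMulCommClass.mk _ _ _ (_) (_) fun k g x =>
    Prod.ext (smul_comm k (op g.unop.1.1) x.1) rfl

/-- With `comp_contr`, this says that a biset applied to the uncontracted variable may be applied
before or after contracting; `contrLeft` is the common value. -/
theorem contr_comp_prod_id_prod_id [Finite K] [Finite H] (U : Biset K L) :
    ((contr K H).comp ((U.prod (Biset.id H)).prod (Biset.id H))).Iso (U.contrLeft H) := by
  let f : K × H → (U.carrier × H) × H → U.carrier × H :=
    fun x y => (x.1 • y.1.1, y.1.2⁻¹ * x.2 * y.2)
  let s : U.carrier × H → (K × H) × ((U.carrier × H) × H) := fun u => ((1, u.2), ((u.1, 1), 1))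
  refine comp_iso_of_section (U := (U.prod (Biset.id H)).prod (Biset.id H))
    (W := U.contrLeft H) f s ?_ ?_ ?_ ?_ ?_
  · rintro k (⟨x, a⟩ : K × H) (⟨⟨u, b⟩, c⟩ : (U.carrier × H) × H)
    exact Prod.ext (mul_smul k x u) rfl
  · rintro ⟨⟨l, h⟩, h'⟩ (⟨x, a⟩ : K × H) (⟨⟨u, b⟩, c⟩ : (U.carrier × H) × H)
    change (x • op l • u, (b * h)⁻¹ * a * (c * h')) = (op l • x • u, h⁻¹ * (b⁻¹ * a * c) * h')
    simp [mul_assoc, op_smul_comm]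
  · rintro ⟨⟨k, h⟩, h'⟩ (⟨x, a⟩ : K × H) (⟨⟨u, b⟩, c⟩ : (U.carrier × H) × H)
    change ((x * k) • u, b⁻¹ * (h⁻¹ * a * h') * c) = (x • k • u, (h * b)⁻¹ * a * (h' * c))
    simp [mul_assoc, mul_smul]
  · rintro (⟨u, a⟩ : U.carrier × H)
    change ((1 : K) • u, 1⁻¹ * a * 1) = (u, a)
    simp
  · rintro (⟨x, a⟩ : K × H) (⟨⟨u, b⟩, c⟩ : (U.carrier × H) × H)
    refine ⟨((x⁻¹, b), c), ?_, ?_⟩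
    · change (x * x⁻¹, b⁻¹ * a * c) = ((1, b⁻¹ * a * c) : K × H)
      simp
    · change ((u, b), c) = ((x⁻¹ • x • u, b * 1), c * 1)
      simp

theorem comp_contr [Finite L] [Finite H] (U : Biset K L) :
    (U.comp (contr L H)).Iso (U.contrLeft H) := by
  let f : U.carrier → L × H → U.carrier × H := fun u y => (op y.1 • u, y.2)
  let s : U.carrier × H → U.carrier × (L × H) := fun u => (u.1, (1, u.2))
  refine comp_iso_of_section (U := contr L H) (W := U.contrLeft H) f s ?_ ?_ ?_ ?_ ?_
  · rintro k u (⟨x, a⟩ : L × H)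
    exact Prod.ext (op_smul_comm _ _ _ _) rfl
  · rintro ⟨⟨l, h⟩, h'⟩ u (⟨x, a⟩ : L × H)
    exact Prod.ext (op_smul_op _ _ _ _).symm rfl
  · rintro l u (⟨x, a⟩ : L × H)
    exact Prod.ext (op_smul_op _ _ _ _) rfl
  · rintro (⟨u, a⟩ : U.carrier × H)
    exact Prod.ext (one_smul _ u) rfl
  · rintro u (⟨x, a⟩ : L × H)
    exact ⟨x, rfl, Prod.ext (mul_one x).symm rfl⟩

/-- The opposite biset. -/
def opp (V : Biset H L) : Biset L H where
  carrier := V.carrier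
  left :=
    { smul := fun l v => op l⁻¹ • v
      one_smul := fun v => op_smul_of_eq_one V inv_one v
      mul_smul := fun a b v => by
        change op (a * b)⁻¹ • v = op a⁻¹ • op b⁻¹ • v
        rw [op_smul_op, mul_inv_rev] }
  right :=
    { smul := fun h v => h.unop⁻¹ • v
      one_smul := fun v => by
        change (1 : H)⁻¹ • v = v
        simp
      mul_smul := fun a b v => by
        change (b.unop * a.unop)⁻¹ • v = a.unop⁻¹ • b.unop⁻¹ • v
        simp [mul_smul] }
  comm := @SMulCommClass.mk _ _ _ (_) (_) fun l h v => op_smul_comm V l⁻¹ h.unop⁻¹ v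

/-- For an `(H, L)`-biset `V`, the `(K, (K × L) × H)`-biset `K × V`. -/
def contrRight (K : Type u) [Group K] [Finite K] (V : Biset H L) : Biset K ((K × L) × H) where
  carrier := K × V.carrier
  left :=
    { smul := fun k x => (k * x.1, x.2)
      one_smul := fun x => Prod.ext (_root_.one_mul x.1) rfl
      mul_smul := fun a b x => Prod.ext (_root_.mul_assoc a b x.1) rfl }
  right :=
    { smul := fun g x => (x.1 * g.unop.1.1, g.unop.2⁻¹ • op g.unop.1.2 • x.2)
      one_smul := fun x => by
        change (x.1 * 1, (1 : H)⁻¹ • op (1 : L) • x.2) = x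
        simp
      mul_smul := fun a b x => by
        change (x.1 * (b.unop.1.1 * a.unop.1.1),
          (b.unop.2 * a.unop.2)⁻¹ • op (b.unop.1.2 * a.unop.1.2) • x.2) =
          (x.1 * b.unop.1.1 * a.unop.1.1,
            a.unop.2⁻¹ • op a.unop.1.2 • b.unop.2⁻¹ • op b.unop.1.2 • x.2)
        simp [mul_assoc, op_smul_op, op_smul_comm, mul_smul, -MulOpposite.op_mul] }
  comm := @SMulCommClass.mk _ _ _ (_) (_) fun k g x =>
    Prod.ext (_root_.mul_assoc k x.1 g.unop.1.1).symm rfl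

/-- With `contr_comp_id_prod_opp`, this says that a biset on one of the two contracted variables may
be moved to the other as its opposite; `contrRight` is the common value. -/
theorem contr_comp_id_prod_prod_id [Finite K] [Finite H] (V : Biset H L) :
    ((contr K H).comp (((Biset.id K).prod V).prod (Biset.id H))).Iso (contrRight K V) := by
  let f : K × H → (K × V.carrier) × H → K × V.carrier :=
    fun x y => (x.1 * y.1.1, (x.2 * y.2)⁻¹ • y.1.2)
  let s : K × V.carrier → (K × H) × ((K × V.carrier) × H) := fun u => ((1, 1), (u, 1))
  refine comp_iso_of_section (U := ((Biset.id K).prod V).prod (Biset.id H))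
    (W := contrRight K V) f s ?_ ?_ ?_ ?_ ?_
  · rintro k (⟨x, a⟩ : K × H) (⟨⟨y, v⟩, c⟩ : (K × V.carrier) × H)
    exact Prod.ext (_root_.mul_assoc k x y) rfl
  · rintro ⟨⟨k, l⟩, h⟩ (⟨x, a⟩ : K × H) (⟨⟨y, v⟩, c⟩ : (K × V.carrier) × H)
    change (x * (y * k), (a * (c * h))⁻¹ • op l • v) = (x * y * k, h⁻¹ • op l • (a * c)⁻¹ • v)
    simp [mul_assoc, mul_smul, op_smul_comm]
  · rintro ⟨⟨k, h⟩, h'⟩ (⟨x, a⟩ : K × H) (⟨⟨y, v⟩, c⟩ : (K × V.carrier) × H)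
    change (x * k * y, (h⁻¹ * a * h' * c)⁻¹ • v) = (x * (k * y), (a * (h' * c))⁻¹ • h • v)
    simp [mul_assoc, mul_smul]
  · rintro (⟨x, v⟩ : K × V.carrier)
    change (1 * x, ((1 : H) * 1)⁻¹ • v) = (x, v)
    simp
  · rintro (⟨x, a⟩ : K × H) (⟨⟨y, v⟩, c⟩ : (K × V.carrier) × H)
    refine ⟨((x⁻¹, a * c), c), ?_, ?_⟩
    · change (x * x⁻¹, (a * c)⁻¹ * a * c) = ((1, 1) : K × H)
      simp [mul_assoc]
    · change ((y, v), c) = ((x⁻¹ * (x * y), (a * c) • (a * c)⁻¹ • v), c * 1)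
      simp [-mul_inv_rev]

theorem contr_comp_id_prod_opp [Finite K] [Finite L] (V : Biset H L) :
    ((contr K L).comp ((Biset.id (K × L)).prod V.opp)).Iso (contrRight K V) := by
  let f : K × L → (K × L) × V.carrier → K × V.carrier :=
    fun x y => (x.1 * y.1.1, op (x.2⁻¹ * y.1.2) • y.2)
  let s : K × V.carrier → (K × L) × ((K × L) × V.carrier) := fun u => ((1, 1), ((u.1, 1), u.2))
  refine comp_iso_of_section (U := (Biset.id (K × L)).prod V.opp)
    (W := contrRight K V) f s ?_ ?_ ?_ ?_ ?_
  · rintro k (⟨x, a⟩ : K × L) (⟨⟨y, b⟩, v⟩ : (K × L) × V.carrier)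
    exact Prod.ext (_root_.mul_assoc k x y) rfl
  · rintro ⟨⟨k, l⟩, h⟩ (⟨x, a⟩ : K × L) (⟨⟨y, b⟩, v⟩ : (K × L) × V.carrier)
    change (x * (y * k), op (a⁻¹ * (b * l)) • h⁻¹ • v) =
      (x * y * k, h⁻¹ • op l • op (a⁻¹ * b) • v)
    simp [mul_assoc, op_smul_op, op_smul_comm, -MulOpposite.op_mul]
  · rintro ⟨⟨k, l⟩, l'⟩ (⟨x, a⟩ : K × L) (⟨⟨y, b⟩, v⟩ : (K × L) × V.carrier)
    change (x * k * y, op ((l⁻¹ * a * l')⁻¹ * b) • v) =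
      (x * (k * y), op (a⁻¹ * (l * b)) • op l'⁻¹ • v)
    simp [mul_assoc, op_smul_op, -MulOpposite.op_mul, -MulOpposite.op_inv]
  · rintro (⟨x, v⟩ : K × V.carrier)
    change (1 * x, op ((1 : L)⁻¹ * 1) • v) = (x, v)
    simp
  · rintro (⟨x, a⟩ : K × L) (⟨⟨y, b⟩, v⟩ : (K × L) × V.carrier)
    refine ⟨((x⁻¹, b), a⁻¹ * b), ?_, ?_⟩
    · change (x * x⁻¹, b⁻¹ * a * (a⁻¹ * b)) = ((1, 1) : K × L)
      simp [mul_assoc]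
    · change ((y, b), v) =
        ((x⁻¹ * (x * y), b * 1), op (a⁻¹ * b)⁻¹ • op (a⁻¹ * b) • v)
      simp [op_smul_op, -MulOpposite.op_mul, -MulOpposite.op_inv, -mul_inv_rev]

/-! ### Sets with a left action -/

theorem op_punit_smul (X : Biset G PUnit.{u + 1}) (t : PUnit.{u + 1}ᵐᵒᵖ) (x : X.carrier) :
    t • x = x := by
  rw [Subsingleton.elim t 1, one_smul]

/-- A left `G`-set as a `(G, 1)`-biset. -/
def ofSet (G X : Type u) [Group G] [Finite X] [MulAction G X] : Biset G PUnit.{u + 1} where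
  carrier := X
  right :=
    { smul := fun _ x => x
      one_smul := fun _ => rfl
      mul_smul := fun _ _ _ => rfl }
  comm := @SMulCommClass.mk _ _ _ (_) (_) fun _ _ _ => rfl

theorem iso_sum_orbit_compl (X : Biset G PUnit.{u + 1}) (x₀ : X.carrier) :
    ∃ Y : Biset G PUnit.{u + 1}, Nat.card Y.carrier < Nat.card X.carrier ∧
      X.Iso ((ofSet G (MulAction.orbit G x₀)).sum Y) := by
  classical
  let S : SubMulAction G X.carrier :=
    { carrier := (MulAction.orbit G x₀)ᶜ
      smul_mem' := fun g x hx h => hx (by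
        rw [MulAction.mem_orbit_symm, MulAction.orbit_smul] at h
        exact MulAction.mem_orbit_symm.1 h) }
  refine ⟨ofSet G S, ?_, ?_⟩
  · refine Finite.card_subtype_lt (p := fun x => x ∈ S) (x := x₀) ?_
    exact fun h => h (MulAction.mem_orbit_self x₀)
  · refine Iso.symm ⟨Equiv.Set.sumCompl (MulAction.orbit G x₀), ?_, ?_⟩
    · rintro g (x | x) <;> rfl
    · rintro g (x | x) <;> exact (op_punit_smul X (op g) _).symm

end Biset

namespace RB

variable {R : Type v} [CommRing R] {G : Type u} [Group G] {N : Type w} [AddCommGroup N] [Module R N]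

/-- A linear map on `RB(G)` that vanishes on all transitive `G`-sets is zero. -/
theorem eq_zero_of_transitive (F : RB R G PUnit.{u + 1} →ₗ[R] N)
    (h : ∀ X : Biset G PUnit.{u + 1}, Nonempty X.carrier → MulAction.IsPretransitive G X.carrier →
      F (of R X) = 0) : F = 0 := by
  refine hom_ext fun X => ?_
  rw [LinearMap.zero_apply]
  induction hn : Nat.card X.carrier using Nat.strong_induction_on generalizing X with
  | _ n ih =>
  subst hn
  rcases isEmpty_or_nonempty X.carrier with hX | ⟨⟨x₀⟩⟩
  -- The empty set is isomorphic to its double, so its class `c` satisfies `c + c = c` and is zero.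
  · have : (X.sum X).Iso X := by
      have : IsEmpty (X.sum X).carrier := inferInstanceAs (IsEmpty (X.carrier ⊕ X.carrier))
      exact ⟨Equiv.equivOfIsEmpty _ _, fun _ x => this.elim x, fun _ x => this.elim x⟩
    have h2 := of_iso (R := R) this
    rw [of_sum] at h2
    rw [add_eq_left.1 h2, map_zero]
  · obtain ⟨Y, hY, hiso⟩ := X.iso_sum_orbit_compl x₀
    rw [of_iso hiso, of_sum, map_add, ih _ hY Y rfl, add_zero]
    exact h _ ⟨⟨x₀, MulAction.mem_orbit_self x₀⟩⟩
      (inferInstanceAs (MulAction.IsPretransitive G (MulAction.orbit G x₀)))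

end RB

/-! ### Factorisations and the maps of `RB_C` -/

namespace Biset

variable {H K C L : Type u} [Group H] [Group K] [Group C] [Group L] [Finite C]

/-- Tensoring `U` with the identity bisets of `H` and `C` turns `U ×_L Z` into a composite over `(L
× H) × C`. So the class of `X` is in the image of `RB_C(U × H)`. -/
theorem exists_iso_comp_of_factorsLeft [Finite H] (X : Biset ((K × H) × C) PUnit.{u + 1})
    (h : FactorsLeft (MulEquiv.prodAssoc : (K × H) × C ≃* K × H × C).symm X.carrier L) :
    ∃ (U : Biset K L) (Y : Biset ((L × H) × C) PUnit.{u + 1}),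
      (((U.prod (Biset.id H)).prod (Biset.id C)).comp Y).Iso X := by
  obtain ⟨U, Z, hZ, actZ, f, h₁, h₂, h₃, h₄, h₅⟩ := h
  let _ : MulAction ((L × H) × C) Z :=
    MulAction.compHom Z (MulEquiv.prodAssoc : (L × H) × C ≃* L × H × C).toMonoidHom
  refine ⟨U, ofSet _ Z, ?_⟩
  refine comp_iso_of_bijective (V := (U.prod (Biset.id H)).prod (Biset.id C)) (U := ofSet _ Z)
    (fun (p : (U.carrier × H) × C) (z : Z) => f p.1.1 (((1, p.1.2, p.2) : L × H × C) • z))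
    ?_ ?_ ?_ ?_ ?_
  · rintro ⟨⟨k, h⟩, c⟩ (⟨⟨u, a⟩, b⟩ : (U.carrier × H) × C) (z : Z)
    change f (k • u) (((1, h * a, c * b) : L × H × C) • z) =
      (((k, h), c) : (K × H) × C) • f u (((1, a, b) : L × H × C) • z)
    rw [h₁, h₂, h₂, smul_smul, smul_smul, ← map_mul]
    congr 1
    simp
  · exact fun g p z => (op_punit_smul X (op g) _).symm
  · rintro ⟨⟨l, h⟩, c⟩ (⟨⟨u, a⟩, b⟩ : (U.carrier × H) × C) (z : Z)
    change f (op l • u) (((1, a * h, b * c) : L × H × C) • z) =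
      f u (((1, a, b) : L × H × C) • ((l, h, c) : L × H × C) • z)
    rw [h₃, smul_smul, smul_smul]
    simp
  · intro x
    obtain ⟨u, z, h⟩ := h₄ x
    exact ⟨((u, (1 : H)), (1 : C)), z, by
      change f u ((1 : L × H × C) • z) = x
      rw [one_smul, h]⟩
  · rintro (⟨⟨u, a⟩, b⟩ : (U.carrier × H) × C) (z : Z)
      (⟨⟨u', a'⟩, b'⟩ : (U.carrier × H) × C) (z' : Z) h
    obtain ⟨l, hl₁, hl₂⟩ := h₅ _ _ _ _ h
    refine ⟨((l, a⁻¹ * a'), b⁻¹ * b'), ?_, ?_⟩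
    · change ((u', a'), b') = ((op l • u, a * (a⁻¹ * a')), b * (b⁻¹ * b'))
      simpa using hl₁
    · change z' = ((l⁻¹, (a⁻¹ * a')⁻¹, (b⁻¹ * b')⁻¹) : L × H × C) • z
      rw [smul_smul, ← eq_inv_smul_iff, smul_smul] at hl₂
      rw [hl₂]
      simp

theorem exists_iso_comp_of_factorsLeft_swap [Finite K] (X : Biset ((K × H) × C) PUnit.{u + 1})
    (h : FactorsLeft ((MulEquiv.prodLeftComm H K C).trans
      (MulEquiv.prodAssoc : (K × H) × C ≃* K × H × C).symm) X.carrier L) :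
    ∃ (V : Biset H L) (Y : Biset ((K × L) × C) PUnit.{u + 1}),
      ((((Biset.id K).prod V).prod (Biset.id C)).comp Y).Iso X := by
  obtain ⟨V, Z, hZ, actZ, f, h₁, h₂, h₃, h₄, h₅⟩ := h
  let _ : MulAction ((K × L) × C) Z :=
    MulAction.compHom Z ((MulEquiv.prodAssoc : (K × L) × C ≃* K × L × C).trans
      (MulEquiv.prodLeftComm K L C)).toMonoidHom
  refine ⟨V, ofSet _ Z, ?_⟩
  refine comp_iso_of_bijective (V := ((Biset.id K).prod V).prod (Biset.id C)) (U := ofSet _ Z)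
    (fun (p : (K × V.carrier) × C) (z : Z) => f p.1.2 (((1, p.1.1, p.2) : L × K × C) • z))
    ?_ ?_ ?_ ?_ ?_
  · rintro ⟨⟨k, h⟩, c⟩ (⟨⟨a, u⟩, b⟩ : (K × V.carrier) × C) (z : Z)
    change f (h • u) (((1, k * a, c * b) : L × K × C) • z) =
      (((k, h), c) : (K × H) × C) • f u (((1, a, b) : L × K × C) • z)
    rw [h₁, h₂, h₂, smul_smul, smul_smul, ← map_mul]
    congr 1
    simp [MulEquiv.prodLeftComm]
  · exact fun g p z => (op_punit_smul X (op g) _).symm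
  · rintro ⟨⟨k, l⟩, c⟩ (⟨⟨a, u⟩, b⟩ : (K × V.carrier) × C) (z : Z)
    change f (op l • u) (((1, a * k, b * c) : L × K × C) • z) =
      f u (((1, a, b) : L × K × C) • ((l, k, c) : L × K × C) • z)
    rw [h₃, smul_smul, smul_smul]
    simp
  · intro x
    obtain ⟨u, z, h⟩ := h₄ x
    exact ⟨(((1 : K), u), (1 : C)), z, by
      change f u ((1 : L × K × C) • z) = x
      rw [one_smul, h]⟩
  · rintro (⟨⟨a, u⟩, b⟩ : (K × V.carrier) × C) (z : Z)
      (⟨⟨a', u'⟩, b'⟩ : (K × V.carrier) × C) (z' : Z) h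
    obtain ⟨l, hl₁, hl₂⟩ := h₅ _ _ _ _ h
    refine ⟨((a⁻¹ * a', l), b⁻¹ * b'), ?_, ?_⟩
    · change ((a', u'), b') = ((a * (a⁻¹ * a'), op l • u), b * (b⁻¹ * b'))
      simpa using hl₁
    · change z' = ((l⁻¹, (a⁻¹ * a')⁻¹, (b⁻¹ * b')⁻¹) : L × K × C) • z
      rw [smul_smul, ← eq_inv_smul_iff, smul_smul] at hl₂
      rw [hl₂]
      simp

end Biset

/-! ### Values on classes of bisets -/

section

variable {R : Type v} [CommRing R]

@[simp] theorem RB.comp_of {K H G : Type u} [Group K] [Group H] [Group G] (V : Biset K H)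
    (U : Biset H G) : RB.comp R (RB.of R V) (RB.of R U) = RB.of R (V.comp U) := by
  simp [RB.comp]

@[simp] theorem RB.prod_of {H G H' G' : Type u} [Group H'] [Group H] [Group G] [Group G']
    (U : Biset H G) (V : Biset H' G') :
    RB.prod R (RB.of R U) (RB.of R V) = RB.of R (U.prod V) := by
  simp [RB.prod]

theorem RBC.map_of {C H G : Type u} [Group C] [Finite C] [Group H] [Group G] (U : Biset H G)
    (X : Biset (G × C) PUnit.{u + 1}) :
    RBC.map R C (RB.of R U) (RB.of R X) = RB.of R ((U.prod (Biset.id C)).comp X) := by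
  simp [RBC.map]

theorem RBC.map_id {C G : Type u} [Group C] [Finite C] [Group G] [Finite G] (a : RBC R C G) :
    RBC.map R C (RB.of R (Biset.id G)) a = a := by
  have h : RBC.map R C (RB.of R (Biset.id G)) = LinearMap.id := RB.hom_ext fun X => by
    rw [RBC.map_of, LinearMap.id_apply]
    exact RB.of_iso ((Biset.comp_iso Biset.id_prod_id (Biset.Iso.refl X)).trans (Biset.id_comp X))
  rw [h, LinearMap.id_apply]

end

/-! ### Annihilators and the action of `RB((K × H) × C)` -/

namespace RBCModule

variable {R : Type v} [CommRing R] {Z : GroupClass.{u}} {C : Z.Obj} (M : RBCModule.{u, v, w} R C)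

theorem mul_map_left {G' G H : Z.Obj} (φ : RB R G' G) (a : RBC R C G) (m : M.obj H) :
    M.mul G' H (RBC.map R C φ a) m =
      M.map (H := G'.prod H) (G := G.prod H) (RB.prod R φ (RB.of R (Biset.id H)))
        (M.mul G H a m) := by
  rw [M.functorial, M.map_id]

theorem mul_map_right {G H' H : Z.Obj} (ψ : RB R H' H) (a : RBC R C G) (m : M.obj H) :
    M.mul G H' a (M.map ψ m) =
      M.map (H := G.prod H') (G := G.prod H) (RB.prod R (RB.of R (Biset.id G)) ψ)
        (M.mul G H a m) := by
  rw [M.functorial, RBC.map_id]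

/-- Associativity solved for the iterated product, which gives stability of `annihilated` under
products. The double `symm` matches `ofEquiv_symm_comp_ofEquiv`. -/
theorem mul_mul (G H K : Z.Obj) (a : RBC R C G) (b : RBC R C H) (m : M.obj K) :
    M.mul G (H.prod K) a (M.mul H K b m) =
      M.map (H := G.prod (H.prod K)) (G := (G.prod H).prod K)
        (RB.of R (Biset.ofEquiv (MulEquiv.prodAssoc : (G × H) × K ≃* G × (H × K)).symm.symm))
        (M.mul (G.prod H) K (RBC.mul R C a b) m) := by
  rw [M.mul_assoc, ← M.map_comp, RB.comp_of, RB.of_iso (Biset.ofEquiv_symm_comp_ofEquiv _)]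
  exact (M.map_id (G.prod (H.prod K)) _).symm

/-- The elements of `M` that generate a submodule vanishing at `K`. -/
def annihilated (K : Z.Obj) : M.Sub where
  sub G :=
    { carrier := {x | ∀ (L : Z.Obj) (a : RBC R C L) (φ : RB R K (L.prod G)),
        M.map φ (M.mul L G a x) = 0}
      add_mem' := fun {x y} hx hy L a φ => by simp [hx L a φ, hy L a φ]
      zero_mem' := fun L a φ => by simp
      smul_mem' := fun r x hx L a φ => by simp [hx L a φ] }
  map_mem := fun {H G} ψ m hm L a φ => by
    rw [mul_map_right, ← M.map_comp]
    exact hm L a _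
  mul_mem := fun {G H} b m hm L a φ => by
    rw [mul_mul, ← M.map_comp]
    exact hm (L.prod G) _ _

variable {M}

theorem IsSimple.exists_map_mul_ne_zero (hM : M.IsSimple) (H K : Z.Obj) [Nontrivial (M.obj H)]
    [Nontrivial (M.obj K)] :
    ∃ (x : M.obj H) (L : Z.Obj) (a : RBC R C L) (φ : RB R K (L.prod H)),
      M.map φ (M.mul L H a x) ≠ 0 := by
  by_contra! h
  rcases hM.2 (M.annihilated K) with h' | h'
  · obtain ⟨x, hx⟩ := exists_ne (0 : M.obj H)
    have : x ∈ (M.annihilated K).sub H := fun L a φ => h x L a φ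
    rw [h', Submodule.mem_bot] at this
    exact hx this
  · obtain ⟨x, hx⟩ := exists_ne (0 : M.obj K)
    have : x ∈ (M.annihilated K).sub K := h' K ▸ Submodule.mem_top
    -- The unit law writes `x` as `M(Iso λ)(ε × x)`, an element of `M(K)` of the annihilated form.
    exact hx ((M.one_mul K x).trans (this _ _ _))

variable (M)

/-- The action of the elements of `RB(K × H × C)` on an element of `M(H)`. -/
noncomputable def act (K H : Z.Obj) (m : M.obj H) : RBC R C (K.prod H) →ₗ[R] M.obj K :=
  (M.map (H := K) (G := (K.prod H).prod H) (RB.of R (Biset.contr K H))) ∘ₗ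
    (M.mul (K.prod H) H).flip m

theorem act_apply (K H : Z.Obj) (m : M.obj H) (a : RBC R C (K.prod H)) :
    M.act K H m a = M.map (H := K) (G := (K.prod H).prod H) (RB.of R (Biset.contr K H))
      (M.mul (K.prod H) H a m) := rfl

/-- Every map into `M(K)` applied to a product with `m` reduces to the single contraction in `act`,
after `U` is absorbed into the coefficient `a`. -/
theorem map_mul_eq_act (K H P : Z.Obj) (m : M.obj H) (a : RBC R C P)
    (U : Biset K (P × H)) :
    M.map (H := K) (G := P.prod H) (RB.of R U) (M.mul P H a m) =
      M.act K H m (RBC.map R C (RB.of R U.shift) a) := by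
  rw [act_apply, mul_map_left (G' := K.prod H), ← M.map_comp, RB.prod_of, RB.comp_of,
    RB.of_iso (Biset.contr_comp_shift_prod U)]

theorem act_map_left (K H L : Z.Obj) (m : M.obj H) (U : Biset K L) (a : RBC R C (L.prod H)) :
    M.act K H m (RBC.map R C (RB.of R (U.prod (Biset.id H))) a) =
      M.map (RB.of R U) (M.act L H m a) := by
  rw [act_apply, act_apply, mul_map_left (G' := K.prod H) (G := L.prod H), ← M.map_comp,
    ← M.map_comp, RB.prod_of, RB.comp_of, RB.comp_of,
    RB.of_iso (Biset.contr_comp_prod_id_prod_id U), RB.of_iso (Biset.comp_contr U)]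

theorem act_map_right (K H L : Z.Obj) (m : M.obj H) (V : Biset H L) (a : RBC R C (K.prod L)) :
    M.act K H m (RBC.map R C (RB.of R ((Biset.id K).prod V)) a) =
      M.act K L (M.map (RB.of R V.opp) m) a := by
  rw [act_apply, act_apply, mul_map_left (G' := K.prod H) (G := K.prod L),
    mul_map_right (G := K.prod L), ← M.map_comp,
    ← M.map_comp, RB.prod_of, RB.prod_of, RB.comp_of, RB.comp_of,
    RB.of_iso (Biset.contr_comp_id_prod_prod_id V), RB.of_iso (Biset.contr_comp_id_prod_opp V)]

variable {M}

/-- Every transitive set factors through a proper subquotient of `K` or `H`; on the side of `K` the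
value comes from `M(L) = 0`, on the side of `H` the element `m` is first sent to `M(L) = 0`. -/
theorem act_eq_zero (hC : (Nat.card C).Prime) {H K : Z.Obj} (hH : M.IsMinimalGroup H)
    (hK : M.IsMinimalGroup K) (hne : IsEmpty (H ≃* K)) (m : M.obj H) : M.act K H m = 0 := by
  have hcard : Nat.card K = Nat.card H := by
    have h₁ := hH.1
    have h₂ := hK.1
    refine le_antisymm (le_of_not_gt fun h => ?_) (le_of_not_gt fun h => ?_)
    · exact not_subsingleton _ (hK.2 H h)
    · exact not_subsingleton _ (hH.2 K h)
  refine RB.eq_zero_of_transitive _ fun X _ _ => ?_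
  rcases nonempty_mulEquiv_or_factorsLeftSmaller hC hcard
    (MulEquiv.prodAssoc : (K × H) × C ≃* K × H × C).symm X.carrier with
    ⟨⟨e⟩⟩ | ⟨L, _, D, π, hπ, hL, h⟩ | ⟨L, _, D, π, hπ, hL, h⟩
  · exact (hne.false e.symm).elim
  · let L' : Z.Obj := ⟨L, Z.subquotient K L D π hπ K.mem⟩
    obtain ⟨U, Y, hY⟩ := X.exists_iso_comp_of_factorsLeft h
    have : Subsingleton (M.obj L') := hK.2 L' hL
    rw [← RB.of_iso hY, ← RBC.map_of]
    refine (M.act_map_left K H L' m U _).trans ?_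
    rw [Subsingleton.elim (M.act L' H m _) 0, map_zero]
  · let L' : Z.Obj := ⟨L, Z.subquotient H L D π hπ H.mem⟩
    obtain ⟨V, Y, hY⟩ := X.exists_iso_comp_of_factorsLeft_swap h
    have : Subsingleton (M.obj L') := hH.2 L' hL
    rw [← RB.of_iso hY, ← RBC.map_of]
    refine (M.act_map_right K H L' m V _).trans ?_
    rw [Subsingleton.elim (M.map (H := L') (RB.of R V.opp) m) 0, act_apply, map_zero, map_zero]

theorem IsSimple.nonempty_mulEquiv (hM : M.IsSimple) (hC : (Nat.card C).Prime) {H K : Z.Obj}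
    (hH : M.IsMinimalGroup H) (hK : M.IsMinimalGroup K) : Nonempty (H ≃* K) := by
  by_contra hne
  have := hH.1
  have := hK.1
  obtain ⟨x, L, a, φ, h⟩ := hM.exists_map_mul_ne_zero H K
  refine h ?_
  -- For fixed `a` and `x` the expression is linear in `φ`, so it suffices to treat classes of
  -- bisets.
  have hφ : M.map.flip (M.mul L H a x) = (0 : RB R K (L.prod H) →ₗ[R] M.obj K) :=
    RB.hom_ext fun U => by
      refine (M.map_mul_eq_act K H L x a U).trans ?_
      rw [act_eq_zero hC hH hK (not_nonempty_iff.1 hne), LinearMap.zero_apply,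
        LinearMap.zero_apply]
  exact LinearMap.congr_fun hφ φ

end RBCModule

/-! ### The two claims -/

theorem corollary4p7 :
    -- a transitive set that does not factor forces `H ≅ K`
    (∀ (C H K : Type u) [Group C] [Group H] [Group K] [Finite H] [Finite K] (n : ℕ),
      (Nat.card C).Prime → Nat.card H = n → Nat.card K = n →
      (∃ (X : Type u) (_ : MulAction (H × K × C) X),
        Nonempty X ∧ MulAction.IsPretransitive (H × K × C) X ∧
        ∀ (L : Type u) [Group L] [Finite L], Nat.card L < n → ¬ FactorsThrough H K C X L) →
      Nonempty (H ≃* K)) ∧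
    -- minimal groups of a simple `RB_C`-module are isomorphic
    (∀ (R : Type v) [CommRing R] (Z : GroupClass.{u}) (C : Z.Obj) (M : RBCModule.{u, v, w} R C),
      (Nat.card C).Prime → M.IsSimple →
      ∀ H K : Z.Obj, M.IsMinimalGroup H → M.IsMinimalGroup K → Nonempty (H ≃* K)) := by
  refine ⟨?_, fun R _ Z C M hC hM H K hH hK => hM.nonempty_mulEquiv hC hH hK⟩
  intro C H K _ _ _ _ _ n hC hH hK ⟨X, actX, ⟨x₀⟩, hX, hfac⟩
  have : Finite C := Nat.finite_of_card_ne_zero hC.ne_zero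
  -- Transitivity under a finite group makes `X` finite.
  have : Finite X := Finite.of_surjective (fun g : H × K × C => g • x₀)
    (MulAction.exists_smul_eq _ x₀)
  have : Nonempty X := ⟨x₀⟩
  rcases nonempty_mulEquiv_or_factorsLeftSmaller hC (hH.trans hK.symm)
    (MulEquiv.refl (H × K × C)) X with
    h | ⟨L, _, D, π, hπ, hL, h⟩ | ⟨L, _, D, π, hπ, hL, h⟩
  · exact h
  · have : Finite L := Finite.of_surjective π hπ
    exact (hfac L (hH ▸ hL) (FactorsThrough.of_factorsLeft h)).elim
  · have : Finite L := Finite.of_surjective π hπ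
    exact (hfac L (hK ▸ hL) (FactorsThrough.of_factorsLeft_swap h)).elim
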